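/- Let $p,q,r\in(1,\infty)$ satisfy $\frac1p+\frac1q=1+\frac1r$, let $s'=\frac{s}{s-1}$ denote the conjugate exponent of $s$, and put $c_1=\frac1p$, $c_2=\frac1q$, $c_3=1-\frac1r$. Let $$K=\Bigl(\frac{p^{1/p}\,q^{1/q}\,{r'}^{1/r'}}{{p'}^{1/p'}\,{q'}^{1/q'}\,r^{1/r}}\Bigr)^{1/2}.$$ (1) For all (real- or complex-valued) $F\in L_p(\mathbb R)$ and $G\in L_q(\mathbb R)$, the convolution $F*G$ is defined almost everywhere and belongs to $L_r(\mathbb R)$. The smallest real number $C$ such that $\|F*G\|_r\le C\,\|F\|_p\,\|G\|_q$ for all such $F,G$ is $C=K$ (Beckner's constant), and $K<1$. (2) $K$ is also the smallest real number $C$ such that $$\int_{\mathbb R^2} f(x+y)^{c_1}\,g(y)^{c_2}\,h(x)^{c_3}\,dx\,dy\le C\Bigl(\int_{\mathbb R} f\Bigr)^{c_1}\Bigl(\int_{\mathbb R} g\Bigr)^{c_2}\Bigl(\int_{\mathbb R} h\Bigr)^{c_3}$$ for all non-negative integrable $f,g,h\colon\mathbb R\to\mathbb R$. In other words, $K$ is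 the Brascamp-Lieb constant of the datum $(c_1,B_1),(c_2,B_2),(c_3,B_3)$ on $\mathbb R^2$ with $B_1=(1,1)$, $B_2=(0,1)$, $B_3=(1,0)$, that is, the smallest real $C$ such that $\int_{\mathbb R^2}\prod_i (f_i\circ B_i)^{c_i}\,dx\le C\prod_i\bigl(\int_{\mathbb R} f_i\bigr)^{c_i}$ for all non-negative integrable $f_1,f_2,f_3$. (3) Consider the condition $$A^{-1}=\sum_{i=1}^3 c_i\,B_i^*\,(B_iAB_i^*)^{-1}B_i \qquad (*)$$ on a matrix $A$. For arbitrary weights $c_1,c_2,c_3>0$ and positive definite $A=\begin{pmatrix}x&z\\z&y\end{pmatrix}$, $(*)$ is equivalent to the system $$(1-c_2)xy+yz+c_2z^2=0,\qquad (1-c_3)xy+xz+c_3z^2=0,\qquad c_1+c_2+c_3=2 .$$ For the weights $c_1=\frac1p$, $c_2=\frac1q$, $c_3=1-\frac1r$, a triple $(x,y,z)\in\mathbb R^3$ with $z\neq0$ solves the first two equations if and only if it is a multiple of $(1,1,-1)$ or a multiple of $\bigl(c_3(1-c_3),\,c_2(1-c_2),\,-(1-c_2)(1-c_3)\bigr)$;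 and $A$ is positive definite and satisfies $(*)$ if and only if $A=t\begin{pmatrix}c_3(1-c_3)&-(1-c_2)(1-c_3)\\-(1-c_2)(1-c_3)&c_2(1-c_2)\end{pmatrix}$ for some $t>0$. (4) For every positive definite $A$ satisfying $(*)$ with these weights, $$K=\Bigl(\frac{\det(A)}{\prod_{i=1}^3\det(B_iAB_i^*)^{c_i}}\Bigr)^{1/2}=\Bigl(\frac{(1-c_1)^{1-c_1}(1-c_2)^{1-c_2}(1-c_3)^{1-c_3}}{c_1^{c_1}c_2^{c_2}c_3^{c_3}}\Bigr)^{1/2}.$$ -/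

import Mathlib

open MeasureTheory
open scoped Matrix

noncomputable section

/-- A Brascamp-Lieb datum on `ℝⁿ`: finitely many pairs `(cᵢ, Bᵢ)` where `cᵢ > 0` and
`Bᵢ : ℝⁿ → ℝ^{nᵢ}` is linear (given by its matrix) and onto. -/
structure BrascampLiebDatum (n m : ℕ) where
  dim : Fin m → ℕ
  c : Fin m → ℝ
  B : ∀ i, Matrix (Fin (dim i)) (Fin n) ℝ
  c_pos : ∀ i, 0 < c i
  onto : ∀ i, Function.Surjective (B i).mulVec

namespace BrascampLiebDatum

variable {n m : ℕ}

/-- The Brascamp-Lieb inequality with constant `C`, for all non-negative integrable functions.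
The left-hand side is a `lintegral`, so that its finiteness is part of the inequality. -/
def Inequality (D : BrascampLiebDatum n m) (C : ℝ) : Prop :=
  ∀ f : ∀ i, (Fin (D.dim i) → ℝ) → ℝ, (∀ i x, 0 ≤ f i x) → (∀ i, Integrable (f i) volume) →
    ∫⁻ x : Fin n → ℝ, ENNReal.ofReal (∏ i, (f i (D.B i *ᵥ x)) ^ D.c i) ≤
      ENNReal.ofReal (C * ∏ i, (∫ y, f i y) ^ D.c i)

/-- `C` is the Brascamp-Lieb constant: the smallest real number for which the inequality holds. -/
def IsConstant (D : BrascampLiebDatum n m) (C : ℝ) : Prop :=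
  IsLeast {C : ℝ | D.Inequality C} C

/-- The condition `A⁻¹ = ∑ᵢ cᵢ Bᵢ* (Bᵢ A Bᵢ*)⁻¹ Bᵢ`. -/
def MatrixCondition (D : BrascampLiebDatum n m) (A : Matrix (Fin n) (Fin n) ℝ) : Prop :=
  A⁻¹ = ∑ i, D.c i • ((D.B i)ᵀ * (D.B i * A * (D.B i)ᵀ)⁻¹ * D.B i)

/-- The number `(det A / ∏ᵢ det (Bᵢ A Bᵢ*)^{cᵢ})^{1/2}`. -/
def gaussianValue (D : BrascampLiebDatum n m) (A : Matrix (Fin n) (Fin n) ℝ) : ℝ :=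
  √(A.det / ∏ i, (D.B i * A * (D.B i)ᵀ).det ^ D.c i)

end BrascampLiebDatum

/-- The three linear forms `(1,1)`, `(0,1)`, `(1,0)` on `ℝ²`. -/
def youngMap : Fin 3 → Matrix (Fin 1) (Fin 2) ℝ :=
  ![!![1, 1], !![0, 1], !![1, 0]]

theorem youngMap_onto (i : Fin 3) : Function.Surjective (youngMap i).mulVec := by
  intro y
  fin_cases i
  · refine ⟨![y 0, 0], ?_⟩
    ext j; fin_cases j; simp [youngMap]
  · refine ⟨![0, y 0], ?_⟩
    ext j; fin_cases j; simp [youngMap]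
  · refine ⟨![y 0, 0], ?_⟩
    ext j; fin_cases j; simp [youngMap]

/-- The datum `(c₁, (1,1)), (c₂, (0,1)), (c₃, (1,0))` on `ℝ²`. -/
def youngDatum (c : Fin 3 → ℝ) (hc : ∀ i, 0 < c i) : BrascampLiebDatum 2 3 where
  dim := fun _ => 1
  c := c
  B := youngMap
  c_pos := hc
  onto := youngMap_onto

/-- The weights `c₁ = 1/p`, `c₂ = 1/q`, `c₃ = 1 - 1/r`. -/
def youngWeight (p q r : ℝ) : Fin 3 → ℝ :=
  ![1 / p, 1 / q, 1 - 1 / r]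

theorem youngWeight_pos {p q r : ℝ} (hp : 1 < p) (hq : 1 < q) (hr : 1 < r) (i : Fin 3) :
    0 < youngWeight p q r i := by
  have hr' : 1 / r < 1 := by rw [div_lt_one (by linarith)]; exact hr
  fin_cases i
  · simp only [youngWeight]; simp; linarith
  · simp only [youngWeight]; simp; linarith
  · simp only [youngWeight]; simpa using hr'

/-- Beckner's constant
`(p^{1/p} q^{1/q} r'^{1/r'} / (p'^{1/p'} q'^{1/q'} r^{1/r}))^{1/2}`, where
`s' = s / (s - 1)` is the conjugate exponent of `s`. -/
def becknerConstant (p q r : ℝ) : ℝ :=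
  √((p ^ (1 / p) * q ^ (1 / q) * r.conjExponent ^ (1 / r.conjExponent)) /
    (p.conjExponent ^ (1 / p.conjExponent) * q.conjExponent ^ (1 / q.conjExponent) *
      r ^ (1 / r)))

/-- The convolution `(F * G)(x) = ∫ F(t) G(x - t) dt` on the real line. -/
def lineConvolution {𝕜 : Type*} [RCLike 𝕜] (F G : ℝ → 𝕜) : ℝ → 𝕜 :=
  convolution F G (ContinuousLinearMap.mul 𝕜 𝕜) volume

/-- `‖F * G‖_r ≤ C ‖F‖_p ‖G‖_q` for all `F ∈ L_p(ℝ)` and `G ∈ L_q(ℝ)`. -/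
def YoungInequality (𝕜 : Type*) [RCLike 𝕜] (p q r C : ℝ) : Prop :=
  ∀ F G : ℝ → 𝕜, MemLp F (ENNReal.ofReal p) volume → MemLp G (ENNReal.ofReal q) volume →
    eLpNorm (lineConvolution F G) (ENNReal.ofReal r) volume ≤
      ENNReal.ofReal C * eLpNorm F (ENNReal.ofReal p) volume *
        eLpNorm G (ENNReal.ofReal q) volume

/-- The inequality
`∫_{ℝ²} f(x+y)^{c₁} g(y)^{c₂} h(x)^{c₃} dx dy ≤ C (∫ f)^{c₁} (∫ g)^{c₂} (∫ h)^{c₃}` for all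
non-negative integrable `f, g, h`. -/
def TrilinearInequality (c₁ c₂ c₃ C : ℝ) : Prop :=
  ∀ f g h : ℝ → ℝ, (∀ x, 0 ≤ f x) → (∀ x, 0 ≤ g x) → (∀ x, 0 ≤ h x) →
    Integrable f volume → Integrable g volume → Integrable h volume →
    ∫⁻ z : ℝ × ℝ, ENNReal.ofReal (f (z.1 + z.2) ^ c₁ * g z.2 ^ c₂ * h z.1 ^ c₃) ≤
      ENNReal.ofReal (C * ((∫ x, f x) ^ c₁ * (∫ x, g x) ^ c₂ * (∫ x, h x) ^ c₃))

end

/-!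
The densities `f`, `g`, `h` are transported by increasing maps `T₁`, `T₂`, `T₃` to centered
Gaussians of variances proportional to `cᵢ (1 - cᵢ)`. At the points `x + y`, `y`, `x`, which fill
the plane `t₁ = t₂ + t₃`, the three maps give a vector `(T₁ (x + y), T₂ y, T₃ x)` of `ℝ³`; its
orthogonal projection back onto that plane, for the norm `∑ tᵢ² / (1 - cᵢ)`, is an injective
function of `(x, y)`. Its Jacobian is the mean of `T₂' T₃'`, `T₁' T₃'`, `T₁' T₂'` with the weights
`1 - cᵢ` of sum `1`, hence at least `∏ (Tᵢ')^{cᵢ}` by AM-GM. As the projection does not increase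
the norm, the trilinear integral of `f`, `g`, `h` is at most that of the three Gaussians, which
are therefore extremal. They are the marginals, under the three linear forms, of a Gaussian on `ℝ²`
whose covariance matrix solves the matrix condition.

Duality between `L_r` and `L_{r'}` turns the trilinear inequality into Young's inequality and back.
-/

/-! ### Monotone transport -/

section
open Set Filter Topology

theorem lt_of_monotone_of_hasDerivAt_pos_left {F : ℝ → ℝ} {d x y : ℝ} (hF : Monotone F)
    (hd : 0 < d) (hx : HasDerivAt F d x) (hxy : x < y) : F x < F y := by
  refine (hF hxy.le).lt_of_ne fun heq => hd.ne' ?_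
  have const : HasDerivWithinAt F 0 (Icc x y) x :=
    (hasDerivWithinAt_const x _ (F x)).congr
      (fun t ht => le_antisymm ((hF ht.2).trans heq.ge) (hF ht.1)) rfl
  exact (uniqueDiffOn_Icc hxy x ⟨le_rfl, hxy.le⟩).eq_deriv _ hx.hasDerivWithinAt const

theorem lt_of_monotone_of_hasDerivAt_pos_right {F : ℝ → ℝ} {d x y : ℝ} (hF : Monotone F)
    (hd : 0 < d) (hy : HasDerivAt F d y) (hxy : x < y) : F x < F y := by
  have reflected : HasDerivAt (fun t => -F (-t)) d (-y) := by
    rw [← neg_neg y] at hy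
    simpa only [Function.comp_def, mul_neg_one, neg_neg] using
      (hy.comp (-y) (hasDerivAt_neg (-y))).fun_neg
  have := lt_of_monotone_of_hasDerivAt_pos_left
    (fun s t hst => neg_le_neg (hF (neg_le_neg hst))) hd reflected (neg_lt_neg hxy)
  simpa using this

/-- The cumulative distribution function of the measure with density `f`. -/
noncomputable def cumulative (f : ℝ → ℝ) (x : ℝ) : ℝ :=
  ∫ t in Iic x, f t

section Cumulative

variable {f : ℝ → ℝ}

theorem monotone_cumulative (hf0 : ∀ x, 0 ≤ f x) (hf : Integrable f) : Monotone (cumulative f) :=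
  fun _ _ hxy => setIntegral_mono_set hf.integrableOn (ae_of_all _ hf0)
    (Iic_subset_Iic.2 hxy).eventuallyLE

theorem cumulative_nonneg (hf0 : ∀ x, 0 ≤ f x) (x : ℝ) : 0 ≤ cumulative f x :=
  setIntegral_nonneg measurableSet_Iic fun t _ => hf0 t

theorem cumulative_le_integral (hf0 : ∀ x, 0 ≤ f x) (hf : Integrable f) (x : ℝ) :
    cumulative f x ≤ ∫ t, f t :=
  setIntegral_le_integral hf (ae_of_all _ hf0)

theorem tendsto_cumulative_atBot : Tendsto (cumulative f) atBot (𝓝 0) :=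
  tendsto_integral_Iic_zero tendsto_id

theorem tendsto_cumulative_atTop (hf : Integrable f) :
    Tendsto (cumulative f) atTop (𝓝 (∫ t, f t)) :=
  (aecover_Iic tendsto_id).integral_tendsto_of_countably_generated hf

theorem cumulative_eq_intervalIntegral_add (hf : Integrable f) :
    cumulative f = fun x => (∫ t in (0 : ℝ)..x, f t) + cumulative f 0 := by
  funext x
  rw [← intervalIntegral.integral_Iic_sub_Iic hf.integrableOn hf.integrableOn]
  exact (sub_add_cancel _ _).symm

theorem ae_hasDerivAt_cumulative (hf : Integrable f) :
    ∀ᵐ x, HasDerivAt (cumulative f) (f x) x := by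
  rw [cumulative_eq_intervalIntegral_add hf]
  filter_upwards [LocallyIntegrable.ae_hasDerivAt_integral hf.locallyIntegrable] with x hx
  exact (hx 0).add_const _

theorem hasStrictDerivAt_cumulative (hf : Integrable f) (hfc : Continuous f) (x : ℝ) :
    HasStrictDerivAt (cumulative f) (f x) x := by
  rw [cumulative_eq_intervalIntegral_add hf]
  exact (intervalIntegral.integral_hasStrictDerivAt_right (hfc.intervalIntegrable _ _)
    (hfc.stronglyMeasurableAtFilter _ _) hfc.continuousAt).add_const _

theorem cumulative_mem_Ioo (hf0 : ∀ x, 0 ≤ f x) (hf : Integrable f) {x : ℝ} (hx : 0 < f x)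
    (hd : HasDerivAt (cumulative f) (f x) x) : cumulative f x ∈ Ioo 0 (∫ t, f t) :=
  have hm := monotone_cumulative hf0 hf
  ⟨(cumulative_nonneg hf0 (x - 1)).trans_lt
      (lt_of_monotone_of_hasDerivAt_pos_right hm hx hd (sub_one_lt x)),
    (lt_of_monotone_of_hasDerivAt_pos_left hm hx hd (lt_add_one x)).trans_le
      (cumulative_le_integral hf0 hf (x + 1))⟩

theorem Ioo_subset_range_cumulative (hf : Integrable f) (hfc : Continuous f) :
    Ioo 0 (∫ t, f t) ⊆ range (cumulative f) := by
  rintro v ⟨h0v, hv⟩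
  have hc : Continuous (cumulative f) := continuous_iff_continuousAt.2 fun x =>
    (hasStrictDerivAt_cumulative hf hfc x).hasDerivAt.continuousAt
  obtain ⟨a, ha⟩ := (tendsto_cumulative_atBot.eventually (gt_mem_nhds h0v)).exists
  obtain ⟨b, hb⟩ := ((tendsto_cumulative_atTop hf).eventually (lt_mem_nhds hv)).exists
  exact mem_range_of_exists_le_of_exists_ge hc ⟨a, ha.le⟩ ⟨b, hb.le⟩

theorem strictMono_cumulative (hf0 : ∀ x, 0 < f x) (hf : Integrable f) (hfc : Continuous f) :
    StrictMono (cumulative f) :=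
  strictMono_of_deriv_pos fun x => by
    rw [(hasStrictDerivAt_cumulative hf hfc x).hasDerivAt.deriv]
    exact hf0 x

end Cumulative

/-- `T` is an increasing map, with derivative `T'` on `s`, which carries the density `f`,
concentrated on `s`, to the density `γ`. -/
structure IsMonotoneTransport (f γ : ℝ → ℝ) (s : Set ℝ) (T T' : ℝ → ℝ) : Prop where
  measurableSet : MeasurableSet s
  ae_mem : ∀ᵐ x, 0 < f x → x ∈ s
  strictMonoOn : StrictMonoOn T s
  hasDerivAt : ∀ x ∈ s, HasDerivAt T (T' x) x
  deriv_pos : ∀ x ∈ s, 0 < T' x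
  density_eq : ∀ x ∈ s, f x = γ (T x) * T' x

theorem exists_measurableSet_hasDerivAt_cumulative {f : ℝ → ℝ} (hf : Integrable f) :
    ∃ s, MeasurableSet s ∧ (∀ᵐ x, 0 < f x → x ∈ s) ∧
      ∀ x ∈ s, 0 < f x ∧ HasDerivAt (cumulative f) (f x) x := by
  have hnull : NullMeasurableSet {x | 0 < f x} volume :=
    nullMeasurableSet_lt aemeasurable_const hf.aemeasurable
  obtain ⟨s, hs, hsm, hae⟩ := hnull.exists_measurable_subset_ae_eq
  obtain ⟨N, hN, hNm, hN0⟩ := exists_measurable_superset_of_null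
    (ae_iff.1 (ae_hasDerivAt_cumulative hf))
  refine ⟨s \ N, hsm.diff hNm, ?_, fun x hx => ⟨hs hx.1, not_not.1 fun h => hx.2 (hN h)⟩⟩
  have hN' : ∀ᵐ x, x ∉ N := measure_eq_zero_iff_ae_notMem.1 hN0
  filter_upwards [hae.mem_iff, hN'] with x hxs hxN hx using ⟨hxs.2 hx, hxN⟩

theorem exists_isMonotoneTransport {f γ : ℝ → ℝ} (hf0 : ∀ x, 0 ≤ f x) (hf : Integrable f)
    (hγ0 : ∀ x, 0 < γ x) (hγ : Integrable γ) (hγc : Continuous γ) (h : ∫ x, f x = ∫ x, γ x) :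
    ∃ s T T', IsMonotoneTransport f γ s T T' := by
  have hmono := strictMono_cumulative hγ0 hγ hγc
  obtain ⟨s, hs, hfs, hsd⟩ := exists_measurableSet_hasDerivAt_cumulative hf
  set T : ℝ → ℝ := fun x => Function.invFun (cumulative γ) (cumulative f x)
  have hT : ∀ x ∈ s, cumulative γ (T x) = cumulative f x := fun x hx =>
    Function.invFun_eq (Ioo_subset_range_cumulative hγ hγc
      (h ▸ cumulative_mem_Ioo hf0 hf (hsd x hx).1 (hsd x hx).2))
  refine ⟨s, T, fun x => (γ (T x))⁻¹ * f x, hs, hfs, fun x hx y hy hxy => ?_, fun x hx => ?_,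
    fun x hx => mul_pos (inv_pos.2 (hγ0 _)) (hsd x hx).1, fun x _ => ?_⟩
  · rw [← hmono.lt_iff_lt, hT x hx, hT y hy]
    exact lt_of_monotone_of_hasDerivAt_pos_left (monotone_cumulative hf0 hf) (hsd x hx).1
      (hsd x hx).2 hxy
  · have hinv := ((hasStrictDerivAt_cumulative hγ hγc (T x)).to_local_left_inverse (hγ0 _).ne'
      (.of_forall (Function.leftInverse_invFun hmono.injective))).hasDerivAt
    rw [hT x hx] at hinv
    exact hinv.comp x (hsd x hx).2
  · rw [mul_inv_cancel_left₀ (hγ0 _).ne']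

end

/-! ### Gaussians and weights -/

theorem lintegral_exp_neg_pi_mul_sq {b : ℝ} (hb : 0 < b) :
    ∫⁻ x : ℝ, ENNReal.ofReal (Real.exp (-Real.pi * (b * x ^ 2))) = ENNReal.ofReal (1 / √b) := by
  simp_rw [show ∀ x : ℝ, -Real.pi * (b * x ^ 2) = -(Real.pi * b) * x ^ 2 from fun x => by ring]
  rw [← ofReal_integral_eq_lintegral_ofReal (integrable_exp_neg_mul_sq (by positivity))
    (ae_of_all _ fun x => (Real.exp_pos _).le), integral_gaussian, div_mul_eq_div_div,
    div_self Real.pi_ne_zero, Real.sqrt_div zero_le_one, Real.sqrt_one]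

theorem lintegral_exp_neg_pi_mul_quadratic {A B C : ℝ} (hA : 0 < A) (hD : 0 < A * C - B ^ 2) :
    ∫⁻ z : ℝ × ℝ, ENNReal.ofReal
        (Real.exp (-Real.pi * (A * z.1 ^ 2 + 2 * B * z.1 * z.2 + C * z.2 ^ 2))) =
      ENNReal.ofReal (1 / √(A * C - B ^ 2)) := by
  have complete_square (x y : ℝ) :
      Real.exp (-Real.pi * (A * x ^ 2 + 2 * B * x * y + C * y ^ 2)) =
        Real.exp (-Real.pi * (A * (x + B / A * y) ^ 2)) *
          Real.exp (-Real.pi * ((A * C - B ^ 2) / A * y ^ 2)) := by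
    rw [← Real.exp_add]
    congr 1
    field_simp
    ring
  have inner (y : ℝ) : ∫⁻ x : ℝ, ENNReal.ofReal
      (Real.exp (-Real.pi * (A * x ^ 2 + 2 * B * x * y + C * y ^ 2))) =
      ENNReal.ofReal (1 / √A) *
        ENNReal.ofReal (Real.exp (-Real.pi * ((A * C - B ^ 2) / A * y ^ 2))) := by
    simp_rw [complete_square, ENNReal.ofReal_mul (Real.exp_pos _).le]
    rw [lintegral_mul_const _ (by fun_prop),
      lintegral_add_right_eq_self
        (fun x => ENNReal.ofReal (Real.exp (-Real.pi * (A * x ^ 2)))) (B / A * y),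
      lintegral_exp_neg_pi_mul_sq hA]
  rw [Measure.volume_eq_prod, lintegral_prod_symm' _ (by fun_prop)]
  simp_rw [inner]
  rw [lintegral_const_mul _ (by fun_prop), lintegral_exp_neg_pi_mul_sq (div_pos hD hA),
    ← ENNReal.ofReal_mul (by positivity), Real.sqrt_div hD.le]
  have := Real.sqrt_pos.2 hA
  have := Real.sqrt_pos.2 hD
  field_simp

theorem sqrt_rpow {x : ℝ} (hx : 0 ≤ x) (c : ℝ) : √x ^ c = √(x ^ c) := by
  rw [← Real.rpow_div_two_eq_sqrt c hx, Real.sqrt_eq_rpow, ← Real.rpow_mul hx, mul_one_div]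

/-- Three weights `cᵢ < 1` of sum `2`, as are `1 / p`, `1 / q`, `1 - 1 / r` for the exponents of
Young's inequality. The numbers `1 - cᵢ` are then positive of sum `1`. -/
structure IsYoungTriple (c₁ c₂ c₃ : ℝ) : Prop where
  lt_one₁ : c₁ < 1
  lt_one₂ : c₂ < 1
  lt_one₃ : c₃ < 1
  sum_eq_two : c₁ + c₂ + c₃ = 2

theorem isYoungTriple_of_exponents {p q r : ℝ} (hp : 1 < p) (hq : 1 < q) (hr : 1 < r)
    (hpqr : 1 / p + 1 / q = 1 + 1 / r) : IsYoungTriple (1 / p) (1 / q) (1 - 1 / r) where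
  lt_one₁ := (div_lt_one (zero_lt_one.trans hp)).2 hp
  lt_one₂ := (div_lt_one (zero_lt_one.trans hq)).2 hq
  lt_one₃ := sub_lt_self _ (one_div_pos.2 (zero_lt_one.trans hr))
  sum_eq_two := by linarith

/-- The Gaussian of variance proportional to `c * (1 - c)`, in the normalisation which makes its
integral `√(c * (1 - c))` and its power of exponent `c` equal to `exp (-π t² / (1 - c))`. -/
noncomputable def extremalGaussian (c t : ℝ) : ℝ :=
  Real.exp (-Real.pi * (t ^ 2 / (c * (1 - c))))

section ExtremalGaussian

variable {c : ℝ}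

theorem extremalGaussian_pos (c t : ℝ) : 0 < extremalGaussian c t := Real.exp_pos _

theorem continuous_extremalGaussian (c : ℝ) : Continuous (extremalGaussian c) := by
  unfold extremalGaussian
  fun_prop

theorem extremalGaussian_eq (c : ℝ) :
    extremalGaussian c = fun t => Real.exp (-(Real.pi / (c * (1 - c))) * t ^ 2) := by
  funext t
  rw [extremalGaussian, neg_mul, neg_mul, mul_div_assoc', div_mul_eq_mul_div]

theorem integrable_extremalGaussian (h0 : 0 < c) (h1 : c < 1) :
    Integrable (extremalGaussian c) := by
  rw [extremalGaussian_eq]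
  exact integrable_exp_neg_mul_sq (div_pos Real.pi_pos (mul_pos h0 (sub_pos.2 h1)))

theorem integral_extremalGaussian (c : ℝ) : ∫ t, extremalGaussian c t = √(c * (1 - c)) := by
  rw [extremalGaussian_eq, integral_gaussian, div_div_cancel₀ Real.pi_ne_zero]

theorem integral_extremalGaussian_pos (h0 : 0 < c) (h1 : c < 1) :
    0 < ∫ t, extremalGaussian c t := by
  rw [integral_extremalGaussian]
  exact Real.sqrt_pos.2 (mul_pos h0 (sub_pos.2 h1))

theorem extremalGaussian_rpow_self (hc : c ≠ 0) (t : ℝ) :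
    extremalGaussian c t ^ c = Real.exp (-Real.pi * (t ^ 2 / (1 - c))) := by
  rw [extremalGaussian, ← Real.exp_mul, mul_assoc, div_mul_eq_mul_div, mul_comm (t ^ 2),
    mul_div_mul_left _ _ hc]

end ExtremalGaussian

/-- The best constant for the weights `c₁`, `c₂`, `c₃`, in closed form. -/
noncomputable def gaussianConstant (c₁ c₂ c₃ : ℝ) : ℝ :=
  √(((1 - c₁) ^ (1 - c₁) * (1 - c₂) ^ (1 - c₂) * (1 - c₃) ^ (1 - c₃)) /
    (c₁ ^ c₁ * c₂ ^ c₂ * c₃ ^ c₃))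

/-- The orthogonal projection of `(t₁, t₂, t₃)` onto the plane `t₁ = t₂ + t₃` for the Euclidean
norm `∑ tᵢ² / (1 - cᵢ)`, written in the coordinates `(t₃, t₂)` of that plane. -/
noncomputable def planeProjection (c₂ c₃ t₁ t₂ t₃ : ℝ) : ℝ × ℝ :=
  (t₃ + (1 - c₃) * (t₁ - t₂ - t₃), t₂ + (1 - c₂) * (t₁ - t₂ - t₃))

/-- The inner product of the norm `∑ tᵢ² / (1 - cᵢ)` on the plane `t₁ = t₂ + t₃`, written in the
coordinates `(t₃, t₂)`. Its matrix is the inverse of a solution of the matrix condition. -/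
noncomputable def planeInner (c₁ c₂ c₃ : ℝ) (v w : ℝ × ℝ) : ℝ :=
  (v.1 + v.2) * (w.1 + w.2) / (1 - c₁) + v.2 * w.2 / (1 - c₂) + v.1 * w.1 / (1 - c₃)

namespace IsYoungTriple

variable {c₁ c₂ c₃ : ℝ} (h : IsYoungTriple c₁ c₂ c₃)

include h

theorem pos₁ : 0 < c₁ := by linarith [h.lt_one₂, h.lt_one₃, h.sum_eq_two]

theorem pos₂ : 0 < c₂ := by linarith [h.lt_one₁, h.lt_one₃, h.sum_eq_two]

theorem pos₃ : 0 < c₃ := by linarith [h.lt_one₁, h.lt_one₂, h.sum_eq_two]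

theorem one_sub_pos₁ : 0 < 1 - c₁ := sub_pos.2 h.lt_one₁

theorem one_sub_pos₂ : 0 < 1 - c₂ := sub_pos.2 h.lt_one₂

theorem one_sub_pos₃ : 0 < 1 - c₃ := sub_pos.2 h.lt_one₃

theorem one_sub_sum : (1 - c₁) + (1 - c₂) + (1 - c₃) = 1 := by linarith [h.sum_eq_two]

theorem prod_rpow_eq {d₁ d₂ d₃ : ℝ} (hd₁ : 0 ≤ d₁) (hd₂ : 0 ≤ d₂) (hd₃ : 0 ≤ d₃) :
    d₁ ^ c₁ * d₂ ^ c₂ * d₃ ^ c₃ =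
      (d₂ * d₃) ^ (1 - c₁) * (d₁ * d₃) ^ (1 - c₂) * (d₁ * d₂) ^ (1 - c₃) := by
  have a₁ := h.one_sub_pos₁.le
  have a₂ := h.one_sub_pos₂.le
  have a₃ := h.one_sub_pos₃.le
  have e₁ : c₁ = (1 - c₂) + (1 - c₃) := by linarith [h.sum_eq_two]
  have e₂ : c₂ = (1 - c₁) + (1 - c₃) := by linarith [h.sum_eq_two]
  have e₃ : c₃ = (1 - c₁) + (1 - c₂) := by linarith [h.sum_eq_two]
  rw [show d₁ ^ c₁ = d₁ ^ (1 - c₂) * d₁ ^ (1 - c₃) by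
      rw [← Real.rpow_add_of_nonneg hd₁ a₂ a₃, ← e₁],
    show d₂ ^ c₂ = d₂ ^ (1 - c₁) * d₂ ^ (1 - c₃) by
      rw [← Real.rpow_add_of_nonneg hd₂ a₁ a₃, ← e₂],
    show d₃ ^ c₃ = d₃ ^ (1 - c₁) * d₃ ^ (1 - c₂) by
      rw [← Real.rpow_add_of_nonneg hd₃ a₁ a₂, ← e₃],
    Real.mul_rpow hd₂ hd₃, Real.mul_rpow hd₁ hd₃, Real.mul_rpow hd₁ hd₂]
  ring

theorem prod_rpow_le_sum {d₁ d₂ d₃ : ℝ} (hd₁ : 0 ≤ d₁) (hd₂ : 0 ≤ d₂) (hd₃ : 0 ≤ d₃) :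
    d₁ ^ c₁ * d₂ ^ c₂ * d₃ ^ c₃ ≤
      (1 - c₁) * (d₂ * d₃) + (1 - c₂) * (d₁ * d₃) + (1 - c₃) * (d₁ * d₂) := by
  rw [h.prod_rpow_eq hd₁ hd₂ hd₃]
  exact Real.geom_mean_le_arith_mean3_weighted h.one_sub_pos₁.le h.one_sub_pos₂.le
    h.one_sub_pos₃.le (mul_nonneg hd₂ hd₃) (mul_nonneg hd₁ hd₃) (mul_nonneg hd₁ hd₂)
    h.one_sub_sum

theorem planeInner_planeProjection (t₁ t₂ t₃ : ℝ) (w : ℝ × ℝ) :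
    planeInner c₁ c₂ c₃ (planeProjection c₂ c₃ t₁ t₂ t₃) w =
      t₁ * (w.1 + w.2) / (1 - c₁) + t₂ * w.2 / (1 - c₂) + t₃ * w.1 / (1 - c₃) := by
  have a₁ := h.one_sub_pos₁.ne'
  have a₂ := h.one_sub_pos₂.ne'
  have a₃ := h.one_sub_pos₃.ne'
  obtain rfl : c₁ = 2 - c₂ - c₃ := by linarith [h.sum_eq_two]
  simp only [planeInner, planeProjection]
  field_simp
  ring

theorem planeInner_planeProjection_self_le (t₁ t₂ t₃ : ℝ) :
    planeInner c₁ c₂ c₃ (planeProjection c₂ c₃ t₁ t₂ t₃) (planeProjection c₂ c₃ t₁ t₂ t₃) ≤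
      t₁ ^ 2 / (1 - c₁) + t₂ ^ 2 / (1 - c₂) + t₃ ^ 2 / (1 - c₃) := by
  have pythagoras : t₁ ^ 2 / (1 - c₁) + t₂ ^ 2 / (1 - c₂) + t₃ ^ 2 / (1 - c₃) =
      planeInner c₁ c₂ c₃ (planeProjection c₂ c₃ t₁ t₂ t₃) (planeProjection c₂ c₃ t₁ t₂ t₃) +
        (t₁ - t₂ - t₃) ^ 2 := by
    rw [h.planeInner_planeProjection]
    have a₁ := h.one_sub_pos₁.ne'
    have a₂ := h.one_sub_pos₂.ne'
    have a₃ := h.one_sub_pos₃.ne'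
    obtain rfl : c₁ = 2 - c₂ - c₃ := by linarith [h.sum_eq_two]
    simp only [planeProjection]
    field_simp
    ring
  rw [pythagoras]
  exact le_add_of_nonneg_right (sq_nonneg _)

theorem prod_extremalGaussian_rpow (t₁ t₂ t₃ : ℝ) :
    extremalGaussian c₁ t₁ ^ c₁ * extremalGaussian c₂ t₂ ^ c₂ * extremalGaussian c₃ t₃ ^ c₃ =
      Real.exp (-Real.pi * (t₁ ^ 2 / (1 - c₁) + t₂ ^ 2 / (1 - c₂) + t₃ ^ 2 / (1 - c₃))) := by
  rw [extremalGaussian_rpow_self h.pos₁.ne', extremalGaussian_rpow_self h.pos₂.ne',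
    extremalGaussian_rpow_self h.pos₃.ne', ← Real.exp_add, ← Real.exp_add]
  congr 1
  ring

theorem prod_extremalGaussian_rpow_le (t₁ t₂ t₃ : ℝ) :
    extremalGaussian c₁ t₁ ^ c₁ * extremalGaussian c₂ t₂ ^ c₂ * extremalGaussian c₃ t₃ ^ c₃ ≤
      Real.exp (-Real.pi * planeInner c₁ c₂ c₃ (planeProjection c₂ c₃ t₁ t₂ t₃)
        (planeProjection c₂ c₃ t₁ t₂ t₃)) := by
  rw [h.prod_extremalGaussian_rpow]
  exact Real.exp_le_exp.2 (mul_le_mul_of_nonpos_left (h.planeInner_planeProjection_self_le t₁ t₂ t₃)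
    (neg_nonpos.2 Real.pi_pos.le))

theorem gaussianConstant_pos : 0 < gaussianConstant c₁ c₂ c₃ := by
  have := h.pos₁
  have := h.pos₂
  have := h.pos₃
  have := h.one_sub_pos₁
  have := h.one_sub_pos₂
  have := h.one_sub_pos₃
  unfold gaussianConstant
  positivity

theorem gaussianConstant_lt_one : gaussianConstant c₁ c₂ c₃ < 1 := by
  have := h.pos₁
  have := h.pos₂
  have := h.pos₃
  have a₁ := h.one_sub_pos₁
  have a₂ := h.one_sub_pos₂
  have a₃ := h.one_sub_pos₃
  have sum := h.sum_eq_two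
  unfold gaussianConstant
  rw [Real.sqrt_lt' one_pos, one_pow, div_lt_one (by positivity),
    h.prod_rpow_eq h.pos₁.le h.pos₂.le h.pos₃.le]
  have m₁ : 1 - c₁ < c₂ * c₃ := by linarith [mul_pos a₂ a₃]
  have m₂ : 1 - c₂ < c₁ * c₃ := by linarith [mul_pos a₁ a₃]
  have m₃ : 1 - c₃ < c₁ * c₂ := by linarith [mul_pos a₁ a₂]
  gcongr

theorem gaussianConstant_eq :
    gaussianConstant c₁ c₂ c₃ = √((1 - c₁) * (1 - c₂) * (1 - c₃) /
      ((c₁ * (1 - c₁)) ^ c₁ * (c₂ * (1 - c₂)) ^ c₂ * (c₃ * (1 - c₃)) ^ c₃)) := by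
  have := h.pos₁
  have := h.pos₂
  have := h.pos₃
  have a₁ := h.one_sub_pos₁
  have a₂ := h.one_sub_pos₂
  have a₃ := h.one_sub_pos₃
  rw [gaussianConstant, Real.rpow_sub a₁, Real.rpow_sub a₂, Real.rpow_sub a₃, Real.rpow_one,
    Real.rpow_one, Real.rpow_one, Real.mul_rpow h.pos₁.le a₁.le, Real.mul_rpow h.pos₂.le a₂.le,
    Real.mul_rpow h.pos₃.le a₃.le]
  congr 1
  field_simp

theorem gaussianConstant_mul_prod_integral :
    gaussianConstant c₁ c₂ c₃ * ((∫ t, extremalGaussian c₁ t) ^ c₁ *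
      (∫ t, extremalGaussian c₂ t) ^ c₂ * (∫ t, extremalGaussian c₃ t) ^ c₃) =
      √((1 - c₁) * (1 - c₂) * (1 - c₃)) := by
  have := h.pos₁
  have := h.pos₂
  have := h.pos₃
  have := h.one_sub_pos₁
  have := h.one_sub_pos₂
  have := h.one_sub_pos₃
  simp only [integral_extremalGaussian, h.gaussianConstant_eq]
  rw [sqrt_rpow (by positivity), sqrt_rpow (by positivity), sqrt_rpow (by positivity),
    ← Real.sqrt_mul (by positivity), ← Real.sqrt_mul (by positivity),
    ← Real.sqrt_mul (by positivity), div_mul_cancel₀ _ (by positivity)]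

end IsYoungTriple

/-! ### The transport argument -/

section
open Set

/-- The combination of three maps `Tᵢ` of the line, at the points `x + y`, `y`, `x`, into a map of
the plane, by projecting `(T₁ (x + y), T₂ y, T₃ x)` back onto the plane of these points. -/
noncomputable def transportMap (c₂ c₃ : ℝ) (T₁ T₂ T₃ : ℝ → ℝ) (z : ℝ × ℝ) : ℝ × ℝ :=
  planeProjection c₂ c₃ (T₁ (z.1 + z.2)) (T₂ z.2) (T₃ z.1)

/-- The derivative of `transportMap c₂ c₃ T₁ T₂ T₃` at a point where the three maps have the
derivatives `d₁`, `d₂`, `d₃`. -/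
noncomputable def transportDeriv (c₂ c₃ d₁ d₂ d₃ : ℝ) : ℝ × ℝ →L[ℝ] ℝ × ℝ :=
  (Matrix.toLin (.finTwoProd ℝ) (.finTwoProd ℝ)
    !![d₃ + (1 - c₃) * (d₁ - d₃), (1 - c₃) * (d₁ - d₂);
      (1 - c₂) * (d₁ - d₃), d₂ + (1 - c₂) * (d₁ - d₂)]).toContinuousLinearMap

theorem hasFDerivAt_transportMap {T₁ T₂ T₃ : ℝ → ℝ} {d₁ d₂ d₃ : ℝ} {z : ℝ × ℝ} (c₂ c₃ : ℝ)
    (h₁ : HasDerivAt T₁ d₁ (z.1 + z.2)) (h₂ : HasDerivAt T₂ d₂ z.2) (h₃ : HasDerivAt T₃ d₃ z.1) :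
    HasFDerivAt (transportMap c₂ c₃ T₁ T₂ T₃) (transportDeriv c₂ c₃ d₁ d₂ d₃) z := by
  have fst : HasFDerivAt Prod.fst (.fst ℝ ℝ ℝ) z := hasFDerivAt_fst
  have snd : HasFDerivAt Prod.snd (.snd ℝ ℝ ℝ) z := hasFDerivAt_snd
  have e₁ : HasFDerivAt (fun z : ℝ × ℝ => T₁ (z.1 + z.2)) _ z :=
    h₁.comp_hasFDerivAt z (fst.fun_add snd)
  have e₂ : HasFDerivAt (fun z : ℝ × ℝ => T₂ z.2) _ z := h₂.comp_hasFDerivAt z snd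
  have e₃ : HasFDerivAt (fun z : ℝ × ℝ => T₃ z.1) _ z := h₃.comp_hasFDerivAt z fst
  have e := (e₁.fun_sub e₂).fun_sub e₃
  refine ((e₃.fun_add (e.const_mul (1 - c₃))).prodMk
    (e₂.fun_add (e.const_mul (1 - c₂)))).congr_fderiv ?_
  rw [transportDeriv, Matrix.toLin_finTwoProd_toContinuousLinearMap]
  ext <;> simp

theorem sub_mul_sub_nonneg_of_monotoneOn {T : ℝ → ℝ} {s : Set ℝ} (hT : MonotoneOn T s) {x y : ℝ}
    (hx : x ∈ s) (hy : y ∈ s) : 0 ≤ (T x - T y) * (x - y) :=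
  (hT.monovaryOn monotoneOn_id).sub_mul_sub_nonneg hy hx

theorem sub_mul_sub_pos_of_strictMonoOn {T : ℝ → ℝ} {s : Set ℝ} (hT : StrictMonoOn T s) {x y : ℝ}
    (hx : x ∈ s) (hy : y ∈ s) (hne : x ≠ y) : 0 < (T x - T y) * (x - y) :=
  (sub_mul_sub_nonneg_of_monotoneOn hT.monotoneOn hx hy).lt_of_ne'
    (mul_ne_zero (sub_ne_zero.2 (hT.injOn.ne hx hy hne)) (sub_ne_zero.2 hne))

namespace IsYoungTriple

variable {c₁ c₂ c₃ : ℝ} (h : IsYoungTriple c₁ c₂ c₃)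

include h

theorem det_transportDeriv (d₁ d₂ d₃ : ℝ) :
    (transportDeriv c₂ c₃ d₁ d₂ d₃).det =
      (1 - c₁) * (d₂ * d₃) + (1 - c₂) * (d₁ * d₃) + (1 - c₃) * (d₁ * d₂) := by
  obtain rfl : c₁ = 2 - c₂ - c₃ := by linarith [h.sum_eq_two]
  rw [transportDeriv, ContinuousLinearMap.det, LinearMap.coe_toContinuousLinearMap,
    LinearMap.det_toLin, Matrix.det_fin_two_of]
  ring

theorem injOn_transportMap {T₁ T₂ T₃ : ℝ → ℝ} {s₁ s₂ s₃ : Set ℝ} (hT₁ : StrictMonoOn T₁ s₁)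
    (hT₂ : StrictMonoOn T₂ s₂) (hT₃ : StrictMonoOn T₃ s₃) :
    InjOn (transportMap c₂ c₃ T₁ T₂ T₃) {z | z.1 + z.2 ∈ s₁ ∧ z.2 ∈ s₂ ∧ z.1 ∈ s₃} := by
  rintro z ⟨hz₁, hz₂, hz₃⟩ w ⟨hw₁, hw₂, hw₃⟩ heq
  -- Pair `transportMap z - transportMap w = 0` with `z - w`: each term is nonnegative.
  have pairing : (T₁ (z.1 + z.2) - T₁ (w.1 + w.2)) * (z.1 + z.2 - (w.1 + w.2)) / (1 - c₁) +
      (T₂ z.2 - T₂ w.2) * (z.2 - w.2) / (1 - c₂) +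
      (T₃ z.1 - T₃ w.1) * (z.1 - w.1) / (1 - c₃) = 0 := by
    have := congrArg (planeInner c₁ c₂ c₃ · (z - w)) heq
    simp only [transportMap, h.planeInner_planeProjection, Prod.fst_sub, Prod.snd_sub] at this
    linear_combination this
  have nonneg₁ := div_nonneg (sub_mul_sub_nonneg_of_monotoneOn hT₁.monotoneOn hz₁ hw₁)
    h.one_sub_pos₁.le
  have nonneg₂ := div_nonneg (sub_mul_sub_nonneg_of_monotoneOn hT₂.monotoneOn hz₂ hw₂)
    h.one_sub_pos₂.le
  have nonneg₃ := div_nonneg (sub_mul_sub_nonneg_of_monotoneOn hT₃.monotoneOn hz₃ hw₃)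
    h.one_sub_pos₃.le
  have snd_eq : z.2 = w.2 := by
    by_contra hne
    linarith [div_pos (sub_mul_sub_pos_of_strictMonoOn hT₂ hz₂ hw₂ hne) h.one_sub_pos₂]
  have fst_eq : z.1 = w.1 := by
    by_contra hne
    linarith [div_pos (sub_mul_sub_pos_of_strictMonoOn hT₃ hz₃ hw₃ hne) h.one_sub_pos₃]
  exact Prod.ext fst_eq snd_eq

end IsYoungTriple

/-- The left-hand side of the trilinear inequality. -/
noncomputable def trilinearForm (c₁ c₂ c₃ : ℝ) (f g h : ℝ → ℝ) : ENNReal :=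
  ∫⁻ z : ℝ × ℝ, ENNReal.ofReal (f (z.1 + z.2) ^ c₁ * g z.2 ^ c₂ * h z.1 ^ c₃)

theorem setLIntegral_eq_lintegral_of_ae_notMem_eq_zero {α : Type*} [MeasurableSpace α]
    {μ : Measure α} {s : Set α} {u : α → ENNReal} (hs : MeasurableSet s)
    (hu : ∀ᵐ x ∂μ, x ∉ s → u x = 0) : ∫⁻ x in s, u x ∂μ = ∫⁻ x, u x ∂μ := by
  rw [← lintegral_indicator hs]
  refine lintegral_congr_ae (hu.mono fun x hx => ?_)
  by_cases hxs : x ∈ s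
  · rw [indicator_of_mem hxs]
  · rw [indicator_of_notMem hxs, hx hxs]

namespace IsYoungTriple

variable {c₁ c₂ c₃ : ℝ} (hc : IsYoungTriple c₁ c₂ c₃)

include hc

theorem ae_rpow_eq_zero_of_notMem {f g h : ℝ → ℝ} {s₁ s₂ s₃ : Set ℝ} (hf0 : ∀ x, 0 ≤ f x)
    (hg0 : ∀ x, 0 ≤ g x) (hh0 : ∀ x, 0 ≤ h x) (hf : ∀ᵐ x, 0 < f x → x ∈ s₁)
    (hg : ∀ᵐ x, 0 < g x → x ∈ s₂) (hh : ∀ᵐ x, 0 < h x → x ∈ s₃) :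
    ∀ᵐ z : ℝ × ℝ, z ∉ {z : ℝ × ℝ | z.1 + z.2 ∈ s₁ ∧ z.2 ∈ s₂ ∧ z.1 ∈ s₃} →
      f (z.1 + z.2) ^ c₁ * g z.2 ^ c₂ * h z.1 ^ c₃ = 0 := by
  have zero_or_mem {φ : ℝ → ℝ} {s : Set ℝ} {x c : ℝ} (hφ : 0 ≤ φ x) (hx : 0 < φ x → x ∈ s)
      (hc : 0 < c) : φ x ^ c = 0 ∨ x ∈ s :=
    hφ.eq_or_lt.imp (fun h0 => by rw [← h0, Real.zero_rpow hc.ne']) hx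
  filter_upwards [(quasiMeasurePreserving_add volume volume).ae hf,
    Measure.quasiMeasurePreserving_snd.ae hg, Measure.quasiMeasurePreserving_fst.ae hh]
    with z h₁ h₂ h₃ hz
  rcases zero_or_mem (hf0 _) h₁ hc.pos₁ with e₁ | m₁
  · rw [e₁, zero_mul, zero_mul]
  rcases zero_or_mem (hg0 _) h₂ hc.pos₂ with e₂ | m₂
  · rw [e₂, mul_zero, zero_mul]
  rcases zero_or_mem (hh0 _) h₃ hc.pos₃ with e₃ | m₃
  · rw [e₃, mul_zero]
  exact absurd ⟨m₁, m₂, m₃⟩ hz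

theorem trilinearForm_extremalGaussian_eq_lintegral :
    trilinearForm c₁ c₂ c₃ (extremalGaussian c₁) (extremalGaussian c₂) (extremalGaussian c₃) =
      ∫⁻ v : ℝ × ℝ, ENNReal.ofReal (Real.exp (-Real.pi * planeInner c₁ c₂ c₃ v v)) := by
  simp only [trilinearForm, hc.prod_extremalGaussian_rpow, planeInner, ← pow_two]

theorem trilinearForm_extremalGaussian :
    trilinearForm c₁ c₂ c₃ (extremalGaussian c₁) (extremalGaussian c₂) (extremalGaussian c₃) =
      ENNReal.ofReal √((1 - c₁) * (1 - c₂) * (1 - c₃)) := by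
  have a₁ := hc.one_sub_pos₁
  have a₂ := hc.one_sub_pos₂
  have a₃ := hc.one_sub_pos₃
  have discriminant : (1 / (1 - c₁) + 1 / (1 - c₃)) * (1 / (1 - c₁) + 1 / (1 - c₂)) -
      (1 / (1 - c₁)) ^ 2 = 1 / ((1 - c₁) * (1 - c₂) * (1 - c₃)) := by
    field_simp
    linear_combination (1 - c₁) * hc.one_sub_sum
  have expand (v : ℝ × ℝ) : planeInner c₁ c₂ c₃ v v =
      (1 / (1 - c₁) + 1 / (1 - c₃)) * v.1 ^ 2 + 2 * (1 / (1 - c₁)) * v.1 * v.2 +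
        (1 / (1 - c₁) + 1 / (1 - c₂)) * v.2 ^ 2 := by
    rw [planeInner]
    ring
  simp_rw [hc.trilinearForm_extremalGaussian_eq_lintegral, expand]
  rw [lintegral_exp_neg_pi_mul_quadratic (by positivity) (by rw [discriminant]; positivity),
    discriminant, one_div, one_div, Real.sqrt_inv, inv_inv]

theorem ofReal_prod_rpow_le_det_transportDeriv {t₁ t₂ t₃ d₁ d₂ d₃ : ℝ} (hd₁ : 0 < d₁)
    (hd₂ : 0 < d₂) (hd₃ : 0 < d₃) :
    ENNReal.ofReal ((extremalGaussian c₁ t₁ * d₁) ^ c₁ * (extremalGaussian c₂ t₂ * d₂) ^ c₂ *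
        (extremalGaussian c₃ t₃ * d₃) ^ c₃) ≤
      ENNReal.ofReal |(transportDeriv c₂ c₃ d₁ d₂ d₃).det| *
        ENNReal.ofReal (Real.exp (-Real.pi * planeInner c₁ c₂ c₃
          (planeProjection c₂ c₃ t₁ t₂ t₃) (planeProjection c₂ c₃ t₁ t₂ t₃))) := by
  rw [← ENNReal.ofReal_mul (abs_nonneg _), hc.det_transportDeriv]
  refine ENNReal.ofReal_le_ofReal ?_
  calc _ = (d₁ ^ c₁ * d₂ ^ c₂ * d₃ ^ c₃) * (extremalGaussian c₁ t₁ ^ c₁ *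
        extremalGaussian c₂ t₂ ^ c₂ * extremalGaussian c₃ t₃ ^ c₃) := by
        rw [Real.mul_rpow (extremalGaussian_pos _ _).le hd₁.le,
          Real.mul_rpow (extremalGaussian_pos _ _).le hd₂.le,
          Real.mul_rpow (extremalGaussian_pos _ _).le hd₃.le]
        ring
    _ ≤ _ := mul_le_mul ((hc.prod_rpow_le_sum hd₁.le hd₂.le hd₃.le).trans (le_abs_self _))
        (hc.prod_extremalGaussian_rpow_le t₁ t₂ t₃)
        (by have := extremalGaussian_pos c₁ t₁; have := extremalGaussian_pos c₂ t₂
            have := extremalGaussian_pos c₃ t₃; positivity) (abs_nonneg _)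

theorem trilinearForm_le_of_isMonotoneTransport {f g h : ℝ → ℝ} {s₁ s₂ s₃ : Set ℝ}
    {T₁ T₂ T₃ T₁' T₂' T₃' : ℝ → ℝ} (hf0 : ∀ x, 0 ≤ f x) (hg0 : ∀ x, 0 ≤ g x) (hh0 : ∀ x, 0 ≤ h x)
    (tr₁ : IsMonotoneTransport f (extremalGaussian c₁) s₁ T₁ T₁')
    (tr₂ : IsMonotoneTransport g (extremalGaussian c₂) s₂ T₂ T₂')
    (tr₃ : IsMonotoneTransport h (extremalGaussian c₃) s₃ T₃ T₃') :
    trilinearForm c₁ c₂ c₃ f g h ≤ trilinearForm c₁ c₂ c₃ (extremalGaussian c₁)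
      (extremalGaussian c₂) (extremalGaussian c₃) := by
  set E : Set (ℝ × ℝ) := {z | z.1 + z.2 ∈ s₁ ∧ z.2 ∈ s₂ ∧ z.1 ∈ s₃}
  have hE : MeasurableSet E := ((measurable_fst.add measurable_snd) tr₁.measurableSet).inter
    ((measurable_snd tr₂.measurableSet).inter (measurable_fst tr₃.measurableSet))
  set S := transportMap c₂ c₃ T₁ T₂ T₃
  set S' := fun z : ℝ × ℝ => transportDeriv c₂ c₃ (T₁' (z.1 + z.2)) (T₂' z.2) (T₃' z.1)
  have hS' : ∀ z ∈ E, HasFDerivWithinAt S (S' z) E z := fun z hz =>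
    (hasFDerivAt_transportMap c₂ c₃ (tr₁.hasDerivAt _ hz.1) (tr₂.hasDerivAt _ hz.2.1)
      (tr₃.hasDerivAt _ hz.2.2)).hasFDerivWithinAt
  have hS : InjOn S E :=
    hc.injOn_transportMap tr₁.strictMonoOn tr₂.strictMonoOn tr₃.strictMonoOn
  have hzero := hc.ae_rpow_eq_zero_of_notMem hf0 hg0 hh0 tr₁.ae_mem tr₂.ae_mem tr₃.ae_mem
  set γ : ℝ × ℝ → ENNReal := fun v =>
    ENNReal.ofReal (Real.exp (-Real.pi * planeInner c₁ c₂ c₃ v v))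
  calc trilinearForm c₁ c₂ c₃ f g h
      = ∫⁻ z in E, ENNReal.ofReal (f (z.1 + z.2) ^ c₁ * g z.2 ^ c₂ * h z.1 ^ c₃) :=
        (setLIntegral_eq_lintegral_of_ae_notMem_eq_zero hE (hzero.mono fun z hz hzE => by
          rw [hz hzE, ENNReal.ofReal_zero])).symm
    _ ≤ ∫⁻ z in E, ENNReal.ofReal |(S' z).det| * γ (S z) := by
        refine setLIntegral_mono' hE fun z hz => ?_
        rw [tr₁.density_eq _ hz.1, tr₂.density_eq _ hz.2.1, tr₃.density_eq _ hz.2.2]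
        exact hc.ofReal_prod_rpow_le_det_transportDeriv (tr₁.deriv_pos _ hz.1)
          (tr₂.deriv_pos _ hz.2.1) (tr₃.deriv_pos _ hz.2.2)
    _ = ∫⁻ v in S '' E, γ v :=
        (lintegral_image_eq_lintegral_abs_det_fderiv_mul _ hE hS' hS γ).symm
    _ ≤ ∫⁻ v, γ v := setLIntegral_le_lintegral _ _
    _ = _ := hc.trilinearForm_extremalGaussian_eq_lintegral.symm

theorem trilinearForm_le_of_integral_eq {f g h : ℝ → ℝ} (hf0 : ∀ x, 0 ≤ f x)
    (hg0 : ∀ x, 0 ≤ g x) (hh0 : ∀ x, 0 ≤ h x) (hf : Integrable f) (hg : Integrable g)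
    (hh : Integrable h) (hfγ : ∫ x, f x = ∫ x, extremalGaussian c₁ x)
    (hgγ : ∫ x, g x = ∫ x, extremalGaussian c₂ x)
    (hhγ : ∫ x, h x = ∫ x, extremalGaussian c₃ x) :
    trilinearForm c₁ c₂ c₃ f g h ≤ trilinearForm c₁ c₂ c₃ (extremalGaussian c₁)
      (extremalGaussian c₂) (extremalGaussian c₃) := by
  obtain ⟨s₁, T₁, T₁', tr₁⟩ := exists_isMonotoneTransport hf0 hf (extremalGaussian_pos c₁)
    (integrable_extremalGaussian hc.pos₁ hc.lt_one₁) (continuous_extremalGaussian c₁) hfγ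
  obtain ⟨s₂, T₂, T₂', tr₂⟩ := exists_isMonotoneTransport hg0 hg (extremalGaussian_pos c₂)
    (integrable_extremalGaussian hc.pos₂ hc.lt_one₂) (continuous_extremalGaussian c₂) hgγ
  obtain ⟨s₃, T₃, T₃', tr₃⟩ := exists_isMonotoneTransport hh0 hh (extremalGaussian_pos c₃)
    (integrable_extremalGaussian hc.pos₃ hc.lt_one₃) (continuous_extremalGaussian c₃) hhγ
  exact hc.trilinearForm_le_of_isMonotoneTransport hf0 hg0 hh0 tr₁ tr₂ tr₃

end IsYoungTriple

end

/-! ### The trilinear inequality -/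

theorem trilinearForm_smul (c₁ c₂ c₃ : ℝ) {f g h : ℝ → ℝ} {a b d : ℝ} (ha : 0 ≤ a) (hb : 0 ≤ b)
    (hd : 0 ≤ d) (hf0 : ∀ x, 0 ≤ f x) (hg0 : ∀ x, 0 ≤ g x) (hh0 : ∀ x, 0 ≤ h x) :
    trilinearForm c₁ c₂ c₃ (a • f) (b • g) (d • h) =
      ENNReal.ofReal (a ^ c₁ * b ^ c₂ * d ^ c₃) * trilinearForm c₁ c₂ c₃ f g h := by
  rw [trilinearForm, trilinearForm, ← lintegral_const_mul' _ _ ENNReal.ofReal_ne_top]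
  refine lintegral_congr fun z => ?_
  rw [← ENNReal.ofReal_mul (by positivity)]
  simp only [Pi.smul_apply, smul_eq_mul]
  rw [Real.mul_rpow ha (hf0 _), Real.mul_rpow hb (hg0 _), Real.mul_rpow hd (hh0 _)]
  congr 1
  ring

theorem exists_eq_smul_integral_eq {f : ℝ → ℝ} {m : ℝ} (hf0 : ∀ x, 0 ≤ f x) (hf : Integrable f)
    (hI : ∫ x, f x ≠ 0) (hm : 0 < m) :
    ∃ (a : ℝ) (f₀ : ℝ → ℝ), 0 ≤ a ∧ (∀ x, 0 ≤ f₀ x) ∧ Integrable f₀ ∧ ∫ x, f₀ x = m ∧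
      f = a • f₀ := by
  have hI0 : 0 ≤ ∫ x, f x := integral_nonneg hf0
  refine ⟨(∫ x, f x) / m, (m / ∫ x, f x) • f, by positivity,
    fun x => mul_nonneg (by positivity) (hf0 x), hf.smul _, ?_, ?_⟩
  · simp only [Pi.smul_apply, smul_eq_mul, integral_const_mul]
    exact div_mul_cancel₀ _ hI
  · rw [smul_smul, div_mul_div_cancel₀ hm.ne', div_self hI, one_smul]

theorem ae_integral_ne_zero_of_pos {f : ℝ → ℝ} (hf0 : ∀ x, 0 ≤ f x) (hf : Integrable f) :
    ∀ᵐ x, 0 < f x → ∫ t, f t ≠ 0 := by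
  by_cases hI : ∫ t, f t = 0
  · filter_upwards [(integral_eq_zero_iff_of_nonneg hf0 hf).1 hI] with x hx hpos
    exact absurd hx hpos.ne'
  · exact ae_of_all _ fun _ _ => hI

namespace IsYoungTriple

variable {c₁ c₂ c₃ : ℝ} (hc : IsYoungTriple c₁ c₂ c₃)

include hc

theorem trilinearForm_eq_zero {f g h : ℝ → ℝ} (hf0 : ∀ x, 0 ≤ f x) (hg0 : ∀ x, 0 ≤ g x)
    (hh0 : ∀ x, 0 ≤ h x) (hf : Integrable f) (hg : Integrable g) (hh : Integrable h)
    (hI : ¬(∫ x, f x ≠ 0 ∧ ∫ x, g x ≠ 0 ∧ ∫ x, h x ≠ 0)) : trilinearForm c₁ c₂ c₃ f g h = 0 := by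
  have hzero := hc.ae_rpow_eq_zero_of_notMem (s₁ := {_x | ∫ t, f t ≠ 0}) (s₂ := {_x | ∫ t, g t ≠ 0})
    (s₃ := {_x | ∫ t, h t ≠ 0}) hf0 hg0 hh0 (ae_integral_ne_zero_of_pos hf0 hf)
    (ae_integral_ne_zero_of_pos hg0 hg) (ae_integral_ne_zero_of_pos hh0 hh)
  rw [trilinearForm, lintegral_congr_ae (hzero.mono fun z hz => by rw [hz hI]),
    ENNReal.ofReal_zero, lintegral_zero]

theorem trilinearInequality_gaussianConstant :
    TrilinearInequality c₁ c₂ c₃ (gaussianConstant c₁ c₂ c₃) := by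
  intro f g h hf0 hg0 hh0 hf hg hh
  change trilinearForm c₁ c₂ c₃ f g h ≤ _
  by_cases hI : ∫ x, f x ≠ 0 ∧ ∫ x, g x ≠ 0 ∧ ∫ x, h x ≠ 0
  swap
  · rw [hc.trilinearForm_eq_zero hf0 hg0 hh0 hf hg hh hI]
    exact zero_le
  obtain ⟨a, f₀, ha, hf₀, hfi, hfm, rfl⟩ := exists_eq_smul_integral_eq hf0 hf hI.1
    (integral_extremalGaussian_pos hc.pos₁ hc.lt_one₁)
  obtain ⟨b, g₀, hb, hg₀, hgi, hgm, rfl⟩ := exists_eq_smul_integral_eq hg0 hg hI.2.1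
    (integral_extremalGaussian_pos hc.pos₂ hc.lt_one₂)
  obtain ⟨d, h₀, hd, hh₀, hhi, hhm, rfl⟩ := exists_eq_smul_integral_eq hh0 hh hI.2.2
    (integral_extremalGaussian_pos hc.pos₃ hc.lt_one₃)
  have hle := hc.trilinearForm_le_of_integral_eq hf₀ hg₀ hh₀ hfi hgi hhi hfm hgm hhm
  rw [hc.trilinearForm_extremalGaussian, ← hc.gaussianConstant_mul_prod_integral,
    ← hfm, ← hgm, ← hhm] at hle
  rw [trilinearForm_smul _ _ _ ha hb hd hf₀ hg₀ hh₀]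
  refine (mul_le_mul_right hle _).trans_eq ?_
  simp only [Pi.smul_apply, smul_eq_mul, integral_const_mul]
  rw [← ENNReal.ofReal_mul (by positivity), Real.mul_rpow ha (integral_nonneg hf₀),
    Real.mul_rpow hb (integral_nonneg hg₀), Real.mul_rpow hd (integral_nonneg hh₀)]
  congr 1
  ring

theorem gaussianConstant_le_of_trilinearInequality {C : ℝ}
    (hC : TrilinearInequality c₁ c₂ c₃ C) : gaussianConstant c₁ c₂ c₃ ≤ C := by
  have κ₁ := integral_extremalGaussian_pos hc.pos₁ hc.lt_one₁
  have κ₂ := integral_extremalGaussian_pos hc.pos₂ hc.lt_one₂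
  have κ₃ := integral_extremalGaussian_pos hc.pos₃ hc.lt_one₃
  have hle := hC _ _ _ (fun x => (extremalGaussian_pos c₁ x).le)
    (fun x => (extremalGaussian_pos c₂ x).le) (fun x => (extremalGaussian_pos c₃ x).le)
    (integrable_extremalGaussian hc.pos₁ hc.lt_one₁)
    (integrable_extremalGaussian hc.pos₂ hc.lt_one₂)
    (integrable_extremalGaussian hc.pos₃ hc.lt_one₃)
  rw [← trilinearForm, hc.trilinearForm_extremalGaussian, ← hc.gaussianConstant_mul_prod_integral,
    ENNReal.ofReal_le_ofReal_iff'] at hle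
  have hK := hc.gaussianConstant_pos
  exact le_of_mul_le_mul_right (hle.resolve_right (by positivity : (0 : ℝ) < _).not_ge)
    (by positivity)

theorem isLeast_trilinearInequality :
    IsLeast {C | TrilinearInequality c₁ c₂ c₃ C} (gaussianConstant c₁ c₂ c₃) :=
  ⟨hc.trilinearInequality_gaussianConstant, fun _ => hc.gaussianConstant_le_of_trilinearInequality⟩

end IsYoungTriple

/-! ### Duality with the convolution -/

theorem rpow_le_of_le_mul_rpow {I A : ENNReal} {r : ℝ} (hr : 1 < r) (hI : I ≠ ⊤)
    (h : I ≤ A * I ^ (1 - 1 / r)) : I ≤ A ^ r := by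
  have hr0 : 0 < r := zero_lt_one.trans hr
  have hc : 0 < 1 - 1 / r := sub_pos.2 ((div_lt_one hr0).2 hr)
  rcases eq_or_ne I 0 with rfl | hI0
  · exact zero_le
  rw [← ENNReal.rpow_inv_le_iff hr0, ← one_div]
  have hne : I ^ (1 - 1 / r) ≠ 0 := by simp only [ne_eq, ENNReal.rpow_eq_zero_iff, hI0, hI,
    false_and, or_self, not_false_eq_true]
  refine (ENNReal.mul_le_mul_iff_left hne (ENNReal.rpow_ne_top_of_nonneg hc.le hI)).1 ?_
  rwa [← ENNReal.rpow_add _ _ hI0 hI, add_sub_cancel, ENNReal.rpow_one]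

section

variable {α : Type*} [MeasurableSpace α] {μ : Measure α}

theorem exists_simpleFunc_le_lt_lintegral [SigmaFinite μ] {u : α → ENNReal} {L : ENNReal}
    (hL : L < ∫⁻ x, u x ∂μ) :
    ∃ φ : SimpleFunc α NNReal,
      (∀ x, (φ x : ENNReal) ≤ u x) ∧ ∫⁻ x, φ x ∂μ ≠ ⊤ ∧ L < ∫⁻ x, φ x ∂μ := by
  rw [lintegral_eq_nnreal] at hL
  simp only [lt_iSup_iff] at hL
  obtain ⟨ψ, hψ, hLψ⟩ := hL
  rw [← SimpleFunc.lintegral_eq_lintegral] at hLψ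
  obtain ⟨φ, hφ, hφt, hLφ⟩ := SimpleFunc.exists_lt_lintegral_simpleFunc_of_lt_lintegral hLψ
  exact ⟨φ, fun x => (ENNReal.coe_le_coe.2 (hφ x)).trans (hψ x), hφt.ne, hLφ⟩

theorem lintegral_rpow_le_of_forall_lintegral_mul_rpow_le [SigmaFinite μ] {u : α → ENNReal}
    {A : ENNReal} {r : ℝ} (hr : 1 < r)
    (H : ∀ h : α → ℝ, (∀ x, 0 ≤ h x) → Integrable h μ →
      ∫⁻ x, u x * ENNReal.ofReal (h x ^ (1 - 1 / r)) ∂μ ≤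
        A * ENNReal.ofReal ((∫ x, h x ∂μ) ^ (1 - 1 / r))) :
    ∫⁻ x, u x ^ r ∂μ ≤ A ^ r := by
  have hr0 : 0 < r := zero_lt_one.trans hr
  have hc : 0 ≤ 1 - 1 / r := sub_nonneg.2 ((div_le_one hr0).2 hr.le)
  by_contra! hlt
  obtain ⟨φ, hφ, hφt, hltφ⟩ := exists_simpleFunc_le_lt_lintegral hlt
  refine hltφ.not_ge (rpow_le_of_le_mul_rpow hr hφt ?_)
  have hint : Integrable (fun x => (φ x : ℝ)) μ :=
    integrable_toReal_of_lintegral_ne_top φ.measurable.coe_nnreal_ennreal.aemeasurable hφt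
  have hofReal : ENNReal.ofReal (∫ x, (φ x : ℝ) ∂μ) = ∫⁻ x, φ x ∂μ := by
    simp_rw [ofReal_integral_eq_lintegral_ofReal hint (ae_of_all _ fun x => (φ x).coe_nonneg),
      ENNReal.ofReal_coe_nnreal]
  refine le_trans (lintegral_mono fun x => ?_)
    ((H _ (fun x => (φ x).coe_nonneg) hint).trans_eq ?_)
  · have hle : (φ x : ENNReal) ^ (1 / r) ≤ u x := by
      rw [one_div, ENNReal.rpow_inv_le_iff hr0]
      exact hφ x
    rw [← ENNReal.ofReal_rpow_of_nonneg (φ x).coe_nonneg hc, ENNReal.ofReal_coe_nnreal]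
    refine le_trans (le_of_eq ?_) (mul_le_mul_left hle _)
    rw [← ENNReal.rpow_add_of_nonneg _ _ (one_div_nonneg.2 hr0.le) hc, add_sub_cancel,
      ENNReal.rpow_one]
  · rw [← ENNReal.ofReal_rpow_of_nonneg (integral_nonneg fun x => (φ x).coe_nonneg) hc, hofReal]

theorem lintegral_ofReal_rpow_rpow_inv {f : α → ℝ} (hf0 : ∀ x, 0 ≤ f x) (hf : Integrable f μ)
    {c : ℝ} (hc : 0 < c) :
    (∫⁻ x, ENNReal.ofReal (f x ^ c) ^ c⁻¹ ∂μ) ^ c = ENNReal.ofReal ((∫ x, f x ∂μ) ^ c) := by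
  simp_rw [← ENNReal.ofReal_rpow_of_nonneg (hf0 _) hc.le, ENNReal.rpow_rpow_inv hc.ne']
  rw [← ofReal_integral_eq_lintegral_ofReal hf (ae_of_all _ hf0),
    ENNReal.ofReal_rpow_of_nonneg (integral_nonneg hf0) hc.le]

variable {𝕜 : Type*} [RCLike 𝕜]

theorem enorm_ofReal_of_nonneg {a : ℝ} (ha : 0 ≤ a) : ‖(a : 𝕜)‖ₑ = ENNReal.ofReal a := by
  rw [← ofReal_norm, RCLike.norm_ofReal, abs_of_nonneg ha]

theorem eLpNorm_ofReal_rpow_one_div {f : α → ℝ} (hf0 : ∀ x, 0 ≤ f x) (hf : Integrable f μ) {p : ℝ}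
    (hp : 0 < p) :
    eLpNorm (fun x => ((f x ^ (1 / p) : ℝ) : 𝕜)) (ENNReal.ofReal p) μ =
      ENNReal.ofReal ((∫ x, f x ∂μ) ^ (1 / p)) := by
  rw [eLpNorm_eq_lintegral_rpow_enorm_toReal (ENNReal.ofReal_pos.2 hp).ne' ENNReal.ofReal_ne_top,
    ENNReal.toReal_ofReal hp.le, ← lintegral_ofReal_rpow_rpow_inv hf0 hf (one_div_pos.2 hp)]
  simp_rw [enorm_ofReal_of_nonneg (Real.rpow_nonneg (hf0 _) _), one_div, inv_inv]

theorem memLp_ofReal_rpow_one_div {f : α → ℝ} (hf0 : ∀ x, 0 ≤ f x) (hf : Integrable f μ) {p : ℝ}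
    (hp : 0 < p) :
    MemLp (fun x => ((f x ^ (1 / p) : ℝ) : 𝕜)) (ENNReal.ofReal p) μ :=
  ⟨(RCLike.continuous_ofReal (K := 𝕜)).comp_aestronglyMeasurable
      (hf.1.aemeasurable.pow_const _).aestronglyMeasurable,
    (eLpNorm_ofReal_rpow_one_div hf0 hf hp).trans_lt ENNReal.ofReal_lt_top⟩

theorem eLpNorm_ofReal_eq_ofReal_integral {E : Type*} [NormedAddCommGroup E] {F : α → E} {p : ℝ}
    (hp : 0 < p) (hF : MemLp F (ENNReal.ofReal p) μ) :
    eLpNorm F (ENNReal.ofReal p) μ = ENNReal.ofReal ((∫ x, ‖F x‖ ^ p ∂μ) ^ (1 / p)) := by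
  rw [hF.eLpNorm_eq_integral_rpow_norm (ENNReal.ofReal_pos.2 hp).ne' ENNReal.ofReal_ne_top,
    ENNReal.toReal_ofReal hp.le, one_div]

theorem integrable_norm_rpow_of_memLp_ofReal {E : Type*} [NormedAddCommGroup E] {F : α → E}
    {p : ℝ} (hp : 0 < p) (hF : MemLp F (ENNReal.ofReal p) μ) :
    Integrable (fun x => ‖F x‖ ^ p) μ := by
  simpa only [ENNReal.toReal_ofReal hp.le] using
    hF.integrable_norm_rpow (ENNReal.ofReal_pos.2 hp).ne' ENNReal.ofReal_ne_top

theorem ofReal_norm_rpow_rpow_one_div {E : Type*} [SeminormedAddCommGroup E] (a : E) {p : ℝ}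
    (hp : p ≠ 0) : ENNReal.ofReal ((‖a‖ ^ p) ^ (1 / p)) = ‖a‖ₑ := by
  rw [one_div, Real.rpow_rpow_inv (norm_nonneg _) hp, ofReal_norm]

end

theorem aemeasurable_trilinearForm_integrand {f g h : ℝ → ℝ} (hf : AEMeasurable f)
    (hg : AEMeasurable g) (hh : AEMeasurable h) (c₁ c₂ c₃ : ℝ) :
    AEMeasurable fun z : ℝ × ℝ =>
      ENNReal.ofReal (f (z.1 + z.2) ^ c₁ * g z.2 ^ c₂ * h z.1 ^ c₃) := by
  have hf_add : AEMeasurable fun z : ℝ × ℝ => f (z.1 + z.2) :=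
    hf.comp_quasiMeasurePreserving (quasiMeasurePreserving_add volume volume)
  have hg_snd : AEMeasurable fun z : ℝ × ℝ => g z.2 :=
    hg.comp_quasiMeasurePreserving Measure.quasiMeasurePreserving_snd
  have hh_fst : AEMeasurable fun z : ℝ × ℝ => h z.1 :=
    hh.comp_quasiMeasurePreserving Measure.quasiMeasurePreserving_fst
  exact (((hf_add.pow_const _).mul (hg_snd.pow_const _)).mul (hh_fst.pow_const _)).ennreal_ofReal

theorem trilinearForm_eq_lintegral_convolution {f g h : ℝ → ℝ} (hf0 : ∀ x, 0 ≤ f x)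
    (hg0 : ∀ x, 0 ≤ g x) (hf : AEMeasurable f) (hg : AEMeasurable g) (hh : AEMeasurable h)
    (c₁ c₂ c₃ : ℝ) :
    trilinearForm c₁ c₂ c₃ f g h =
      ∫⁻ x, (∫⁻ t, ENNReal.ofReal (f t ^ c₁) * ENNReal.ofReal (g (t - x) ^ c₂)) *
        ENNReal.ofReal (h x ^ c₃) := by
  rw [trilinearForm, Measure.volume_eq_prod,
    lintegral_prod _ (aemeasurable_trilinearForm_integrand hf hg hh _ _ _)]
  refine lintegral_congr fun x => ?_
  rw [← lintegral_mul_const' _ _ ENNReal.ofReal_ne_top,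
    ← lintegral_add_left_eq_self (fun t => ENNReal.ofReal (f t ^ c₁) *
      ENNReal.ofReal (g (t - x) ^ c₂) * ENNReal.ofReal (h x ^ c₃)) x]
  refine lintegral_congr fun y => ?_
  have hfx := Real.rpow_nonneg (hf0 (x + y)) c₁
  have hgy := Real.rpow_nonneg (hg0 y) c₂
  rw [add_sub_cancel_left, ENNReal.ofReal_mul (mul_nonneg hfx hgy), ENNReal.ofReal_mul hfx]

theorem lintegral_enorm_mul_rpow_le {α E : Type*} [MeasurableSpace α] {μ : Measure α}
    [NormedAddCommGroup E] {F : α → E} {r : ℝ} (hr : 1 < r) (hF : AEStronglyMeasurable F μ)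
    {h : α → ℝ} (hh0 : ∀ x, 0 ≤ h x) (hh : Integrable h μ) :
    ∫⁻ x, ‖F x‖ₑ * ENNReal.ofReal (h x ^ (1 - 1 / r)) ∂μ ≤
      eLpNorm F (ENNReal.ofReal r) μ * ENNReal.ofReal ((∫ x, h x ∂μ) ^ (1 - 1 / r)) := by
  have hr0 : 0 < r := zero_lt_one.trans hr
  have hconj : r.HolderConjugate (1 - 1 / r)⁻¹ :=
    Real.holderConjugate_iff.2 ⟨hr, by rw [inv_inv]; ring⟩
  have hc : 0 < 1 - 1 / r := sub_pos.2 ((div_lt_one hr0).2 hr)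
  refine (ENNReal.lintegral_mul_le_Lp_mul_Lq μ hconj hF.enorm
    (hh.1.aemeasurable.pow_const _).ennreal_ofReal).trans_eq ?_
  rw [← lintegral_ofReal_rpow_rpow_inv hh0 hh hc, one_div (1 - 1 / r)⁻¹, inv_inv,
    eLpNorm_eq_lintegral_rpow_enorm_toReal (ENNReal.ofReal_pos.2 hr0).ne' ENNReal.ofReal_ne_top,
    ENNReal.toReal_ofReal hr0.le]

section

variable {𝕜 : Type*} [RCLike 𝕜]

theorem aemeasurable_lintegral_enorm_mul {F G : ℝ → 𝕜} (hF : AEStronglyMeasurable F)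
    (hG : AEStronglyMeasurable G) : AEMeasurable fun x => ∫⁻ t, ‖F t‖ₑ * ‖G (x - t)‖ₑ := by
  have h : AEMeasurable (fun z : ℝ × ℝ => ‖F z.2‖ₑ * ‖G (z.1 - z.2)‖ₑ)
      (volume.prod volume) :=
    (hF.enorm.comp_quasiMeasurePreserving Measure.quasiMeasurePreserving_snd).mul
      (hG.enorm.comp_quasiMeasurePreserving (quasiMeasurePreserving_sub volume volume))
  exact h.lintegral_prod_right'

theorem enorm_lineConvolution_le (F G : ℝ → 𝕜) (x : ℝ) :
    ‖lineConvolution F G x‖ₑ ≤ ∫⁻ t, ‖F t‖ₑ * ‖G (x - t)‖ₑ := by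
  refine (enorm_integral_le_lintegral_enorm _).trans_eq ?_
  simp only [ContinuousLinearMap.mul_apply', enorm_mul]

theorem enorm_lineConvolution_ofReal {φ ψ : ℝ → ℝ} (hφ : ∀ x, 0 ≤ φ x) (hψ : ∀ x, 0 ≤ ψ x)
    {x : ℝ} (hx : ConvolutionExistsAt (fun t => (φ t : 𝕜)) (fun t => (ψ t : 𝕜)) x
      (ContinuousLinearMap.mul 𝕜 𝕜) volume) :
    ‖lineConvolution (fun t => (φ t : 𝕜)) (fun t => (ψ t : 𝕜)) x‖ₑ =
      ∫⁻ t, ENNReal.ofReal (φ t) * ENNReal.ofReal (ψ (x - t)) := by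
  have hnonneg (t : ℝ) : 0 ≤ φ t * ψ (x - t) := mul_nonneg (hφ t) (hψ _)
  have hint : Integrable fun t => φ t * ψ (x - t) := by
    simpa only [ContinuousLinearMap.mul_apply', ← RCLike.ofReal_mul, RCLike.norm_ofReal,
      abs_of_nonneg (hnonneg _)] using hx.integrable.norm
  rw [lineConvolution, convolution_def]
  simp only [ContinuousLinearMap.mul_apply', ← RCLike.ofReal_mul]
  rw [integral_ofReal, enorm_ofReal_of_nonneg (integral_nonneg hnonneg),
    ofReal_integral_eq_lintegral_ofReal hint (ae_of_all _ hnonneg)]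
  exact lintegral_congr fun t => ENNReal.ofReal_mul (hφ t)

variable {p q r C : ℝ}

theorem lintegral_convolution_mul_rpow_le (hp : 0 < p) (hq : 0 < q)
    (hC : TrilinearInequality (1 / p) (1 / q) (1 - 1 / r) C) {F G : ℝ → 𝕜}
    (hF : MemLp F (ENNReal.ofReal p)) (hG : MemLp G (ENNReal.ofReal q)) {h : ℝ → ℝ}
    (hh0 : ∀ x, 0 ≤ h x) (hh : Integrable h) :
    ∫⁻ x, (∫⁻ t, ‖F t‖ₑ * ‖G (x - t)‖ₑ) * ENNReal.ofReal (h x ^ (1 - 1 / r)) ≤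
      ENNReal.ofReal C * eLpNorm F (ENNReal.ofReal p) volume *
        eLpNorm G (ENNReal.ofReal q) volume * ENNReal.ofReal ((∫ x, h x) ^ (1 - 1 / r)) := by
  have hf := integrable_norm_rpow_of_memLp_ofReal hp hF
  have hg := (integrable_norm_rpow_of_memLp_ofReal hq hG).comp_neg
  have hf0 : ∀ x, 0 ≤ ‖F x‖ ^ p := fun x => Real.rpow_nonneg (norm_nonneg _) _
  have hg0 : ∀ x, 0 ≤ ‖G x‖ ^ q := fun x => Real.rpow_nonneg (norm_nonneg _) _
  have hle : trilinearForm (1 / p) (1 / q) (1 - 1 / r) (fun x => ‖F x‖ ^ p)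
      (fun x => ‖G (-x)‖ ^ q) h ≤ _ := hC _ _ h hf0 (fun x => hg0 (-x)) hh0 hf hg hh
  rw [trilinearForm_eq_lintegral_convolution hf0 (fun x => hg0 (-x))
    hf.1.aemeasurable hg.1.aemeasurable hh.1.aemeasurable,
    integral_neg_eq_self (fun x => ‖G x‖ ^ q) volume] at hle
  simp_rw [neg_sub, ofReal_norm_rpow_rpow_one_div _ hp.ne',
    ofReal_norm_rpow_rpow_one_div _ hq.ne'] at hle
  have hIg := Real.rpow_nonneg (integral_nonneg hg0 : 0 ≤ ∫ x, ‖G x‖ ^ q) (1 / q)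
  have hIh := Real.rpow_nonneg (integral_nonneg hh0 : 0 ≤ ∫ x, h x) (1 - 1 / r)
  refine hle.trans_eq ?_
  rw [eLpNorm_ofReal_eq_ofReal_integral hp hF, eLpNorm_ofReal_eq_ofReal_integral hq hG,
    ← mul_assoc, ← mul_assoc, ENNReal.ofReal_mul' hIh, ENNReal.ofReal_mul' hIg,
    ENNReal.ofReal_mul' (Real.rpow_nonneg (integral_nonneg hf0) _)]

theorem lintegral_convolution_rpow_le (hp : 0 < p) (hq : 0 < q) (hr : 1 < r)
    (hC : TrilinearInequality (1 / p) (1 / q) (1 - 1 / r) C) {F G : ℝ → 𝕜}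
    (hF : MemLp F (ENNReal.ofReal p)) (hG : MemLp G (ENNReal.ofReal q)) :
    ∫⁻ x, (∫⁻ t, ‖F t‖ₑ * ‖G (x - t)‖ₑ) ^ r ≤
      (ENNReal.ofReal C * eLpNorm F (ENNReal.ofReal p) volume *
        eLpNorm G (ENNReal.ofReal q) volume) ^ r :=
  lintegral_rpow_le_of_forall_lintegral_mul_rpow_le hr fun _ hh0 hh =>
    lintegral_convolution_mul_rpow_le hp hq hC hF hG hh0 hh

theorem ae_convolutionExistsAt (hp : 0 < p) (hq : 0 < q) (hr : 1 < r)
    (hC : TrilinearInequality (1 / p) (1 / q) (1 - 1 / r) C) {F G : ℝ → 𝕜}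
    (hF : MemLp F (ENNReal.ofReal p)) (hG : MemLp G (ENNReal.ofReal q)) :
    ∀ᵐ x : ℝ, ConvolutionExistsAt F G x (ContinuousLinearMap.mul 𝕜 𝕜) volume := by
  have hr0 : 0 < r := zero_lt_one.trans hr
  have hfin : ∫⁻ x, (∫⁻ t, ‖F t‖ₑ * ‖G (x - t)‖ₑ) ^ r ≠ ⊤ :=
    ne_top_of_le_ne_top (ENNReal.rpow_ne_top_of_nonneg hr0.le
      (ENNReal.mul_ne_top (ENNReal.mul_ne_top ENNReal.ofReal_ne_top hF.2.ne) hG.2.ne))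
      (lintegral_convolution_rpow_le hp hq hr hC hF hG)
  filter_upwards [ae_lt_top' ((aemeasurable_lintegral_enorm_mul hF.1 hG.1).pow_const r) hfin]
    with x hx
  refine ⟨hF.1.convolution_integrand_snd _ hG.1 x, ?_⟩
  rw [hasFiniteIntegral_iff_enorm]
  simp only [ContinuousLinearMap.mul_apply', enorm_mul]
  exact (ENNReal.rpow_lt_top_iff_of_pos hr0).1 hx

theorem youngInequality_of_trilinearInequality (hp : 0 < p) (hq : 0 < q) (hr : 1 < r)
    (hC : TrilinearInequality (1 / p) (1 / q) (1 - 1 / r) C) : YoungInequality 𝕜 p q r C := by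
  intro F G hF hG
  have hr0 : 0 < r := zero_lt_one.trans hr
  rw [eLpNorm_eq_lintegral_rpow_enorm_toReal (ENNReal.ofReal_pos.2 hr0).ne' ENNReal.ofReal_ne_top,
    ENNReal.toReal_ofReal hr0.le, one_div, ENNReal.rpow_inv_le_iff hr0]
  exact (lintegral_mono fun x => ENNReal.rpow_le_rpow (enorm_lineConvolution_le F G x) hr0.le).trans
    (lintegral_convolution_rpow_le hp hq hr hC hF hG)

theorem aestronglyMeasurable_lineConvolution {F G : ℝ → 𝕜} (hF : AEStronglyMeasurable F)
    (hG : AEStronglyMeasurable G) : AEStronglyMeasurable (lineConvolution F G) :=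
  (hF.convolution_integrand (ContinuousLinearMap.mul 𝕜 𝕜) hG).integral_prod_right'

theorem YoungInequality.memLp_lineConvolution (hC : YoungInequality 𝕜 p q r C) {F G : ℝ → 𝕜}
    (hF : MemLp F (ENNReal.ofReal p)) (hG : MemLp G (ENNReal.ofReal q)) :
    MemLp (lineConvolution F G) (ENNReal.ofReal r) :=
  ⟨aestronglyMeasurable_lineConvolution hF.1 hG.1, (hC F G hF hG).trans_lt
    (ENNReal.mul_lt_top (ENNReal.mul_lt_top ENNReal.ofReal_lt_top hF.2) hG.2)⟩

theorem trilinearForm_eq_lintegral_enorm_lineConvolution (hp : 0 < p) (hq : 0 < q) (hr : 1 < r)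
    (hC : TrilinearInequality (1 / p) (1 / q) (1 - 1 / r) C) {f g h : ℝ → ℝ}
    (hf0 : ∀ x, 0 ≤ f x) (hg0 : ∀ x, 0 ≤ g x) (hf : Integrable f) (hg : Integrable g)
    (hh : Integrable h) :
    trilinearForm (1 / p) (1 / q) (1 - 1 / r) f g h =
      ∫⁻ x, ‖lineConvolution (fun t => ((f t ^ (1 / p) : ℝ) : 𝕜))
        (fun t => ((g (-t) ^ (1 / q) : ℝ) : 𝕜)) x‖ₑ * ENNReal.ofReal (h x ^ (1 - 1 / r)) := by
  rw [trilinearForm_eq_lintegral_convolution hf0 hg0 hf.1.aemeasurable hg.1.aemeasurable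
    hh.1.aemeasurable]
  refine lintegral_congr_ae ?_
  filter_upwards [ae_convolutionExistsAt (𝕜 := 𝕜) hp hq hr hC (memLp_ofReal_rpow_one_div hf0 hf hp)
    (memLp_ofReal_rpow_one_div (fun x => hg0 (-x)) hg.comp_neg hq)] with x hx
  rw [enorm_lineConvolution_ofReal (fun t => Real.rpow_nonneg (hf0 t) _)
    (fun t => Real.rpow_nonneg (hg0 (-t)) _) hx]
  simp_rw [neg_sub]

theorem YoungInequality.trilinearInequality {K : ℝ} (hp : 0 < p) (hq : 0 < q) (hr : 1 < r)
    (hK : TrilinearInequality (1 / p) (1 / q) (1 - 1 / r) K) (hC : YoungInequality 𝕜 p q r C) :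
    TrilinearInequality (1 / p) (1 / q) (1 - 1 / r) C := by
  intro f g h hf0 hg0 hh0 hf hg hh
  have hF := memLp_ofReal_rpow_one_div (𝕜 := 𝕜) hf0 hf hp
  have hG := memLp_ofReal_rpow_one_div (𝕜 := 𝕜) (fun x => hg0 (-x)) hg.comp_neg hq
  have hIg := Real.rpow_nonneg (integral_nonneg hg0 : 0 ≤ ∫ x, g x) (1 / q)
  have hIh := Real.rpow_nonneg (integral_nonneg hh0 : 0 ≤ ∫ x, h x) (1 - 1 / r)
  have young := hC _ _ hF hG
  rw [eLpNorm_ofReal_rpow_one_div hf0 hf hp,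
    eLpNorm_ofReal_rpow_one_div (fun x => hg0 (-x)) hg.comp_neg hq, integral_neg_eq_self g volume,
    ← ENNReal.ofReal_mul' (Real.rpow_nonneg (integral_nonneg hf0) _),
    ← ENNReal.ofReal_mul' hIg] at young
  rw [← trilinearForm,
    trilinearForm_eq_lintegral_enorm_lineConvolution (𝕜 := 𝕜) hp hq hr hK hf0 hg0 hf hg hh,
    ← mul_assoc, ← mul_assoc, ENNReal.ofReal_mul' hIh]
  exact (lintegral_enorm_mul_rpow_le hr (aestronglyMeasurable_lineConvolution hF.1 hG.1) hh0
    hh).trans (mul_le_mul_left young _)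

end

/-! ### The Brascamp-Lieb datum -/

theorem youngMap_mulVec (i : Fin 3) (x : Fin 2 → ℝ) :
    youngMap i *ᵥ x = fun _ => ![x 0 + x 1, x 1, x 0] i := by
  ext j
  fin_cases i <;> fin_cases j <;> simp [youngMap, Matrix.mulVec, dotProduct, Fin.sum_univ_two]

theorem lintegral_prod_comp_youngMap (c : Fin 3 → ℝ) (f : Fin 3 → ℝ → ℝ) :
    ∫⁻ x : Fin 2 → ℝ, ENNReal.ofReal (∏ i, f i ((youngMap i *ᵥ x) 0) ^ c i) =
      trilinearForm (c 0) (c 1) (c 2) (f 0) (f 1) (f 2) := by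
  rw [trilinearForm, ← (volume_preserving_finTwoArrow ℝ).lintegral_comp_emb
    (MeasurableEquiv.finTwoArrow (α := ℝ)).measurableEmbedding]
  simp only [Fin.prod_univ_three, youngMap_mulVec]
  rfl

theorem integrable_comp_apply_zero {f : ℝ → ℝ} :
    Integrable (fun y : Fin 1 → ℝ => f (y 0)) ↔ Integrable f :=
  (volume_preserving_funUnique (Fin 1) ℝ).integrable_comp_emb
    (MeasurableEquiv.funUnique (Fin 1) ℝ).measurableEmbedding

theorem integral_comp_apply_zero (f : ℝ → ℝ) : ∫ y : Fin 1 → ℝ, f (y 0) = ∫ x, f x :=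
  (volume_preserving_funUnique (Fin 1) ℝ).integral_comp
    (MeasurableEquiv.funUnique (Fin 1) ℝ).measurableEmbedding f

theorem youngDatum_inequality_iff (c : Fin 3 → ℝ) (hc : ∀ i, 0 < c i) (C : ℝ) :
    (youngDatum c hc).Inequality C ↔ TrilinearInequality (c 0) (c 1) (c 2) C := by
  have hprod (f : Fin 3 → ℝ → ℝ) : ∏ i, (∫ y : Fin 1 → ℝ, f i (y 0)) ^ c i =
      (∫ x, f 0 x) ^ c 0 * (∫ x, f 1 x) ^ c 1 * (∫ x, f 2 x) ^ c 2 := by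
    simp only [integral_comp_apply_zero, Fin.prod_univ_three]
  constructor
  · intro H f g h hf0 hg0 hh0 hf hg hh
    have hle := H (fun i (y : Fin 1 → ℝ) => ![f, g, h] i (y 0))
      (Fin.forall_fin_succ.2 ⟨fun x => hf0 _,
        Fin.forall_fin_two.2 ⟨fun x => hg0 _, fun x => hh0 _⟩⟩)
      (Fin.forall_fin_succ.2 ⟨integrable_comp_apply_zero.2 hf, Fin.forall_fin_two.2
        ⟨integrable_comp_apply_zero.2 hg, integrable_comp_apply_zero.2 hh⟩⟩)
    exact ((lintegral_prod_comp_youngMap c ![f, g, h]).ge.trans hle).trans_eq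
      (congrArg (fun t => ENNReal.ofReal (C * t)) (hprod ![f, g, h]))
  · intro H f hf0 hf
    obtain ⟨g, rfl⟩ : ∃ g : Fin 3 → ℝ → ℝ, f = fun i (y : Fin 1 → ℝ) => g i (y 0) :=
      ⟨fun i x => f i fun _ => x, funext₂ fun i y => congrArg (f i) (funext fun j =>
        congrArg y (Subsingleton.elim (α := Fin 1) j 0))⟩
    have hle := H (g 0) (g 1) (g 2) (fun x => hf0 0 fun _ => x) (fun x => hf0 1 fun _ => x)
      (fun x => hf0 2 fun _ => x) (integrable_comp_apply_zero.1 (hf 0))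
      (integrable_comp_apply_zero.1 (hf 1)) (integrable_comp_apply_zero.1 (hf 2))
    exact ((lintegral_prod_comp_youngMap c g).le.trans hle).trans_eq
      (congrArg (fun t => ENNReal.ofReal (C * t)) (hprod g).symm)

theorem posDef_fin_two_iff {x y z : ℝ} :
    !![x, z; z, y].PosDef ↔ 0 < x ∧ 0 < x * y - z ^ 2 := by
  constructor
  · intro h
    have hdet := h.det_pos
    rw [Matrix.det_fin_two_of, ← sq] at hdet
    exact ⟨h.diag_pos (i := 0), hdet⟩
  · rintro ⟨hx, hD⟩
    refine Matrix.PosDef.of_dotProduct_mulVec_pos ?_ fun v hv => ?_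
    · ext i j
      fin_cases i <;> fin_cases j <;> simp
    have complete_square : star v ⬝ᵥ (!![x, z; z, y] *ᵥ v) =
        ((x * v 0 + z * v 1) ^ 2 + (x * y - z ^ 2) * v 1 ^ 2) / x := by
      simp only [star_trivial, Matrix.mulVec, dotProduct, Fin.sum_univ_two, Matrix.of_apply,
        Matrix.cons_val_zero, Matrix.cons_val_one]
      field_simp
      ring
    rw [complete_square]
    refine div_pos ?_ hx
    rcases eq_or_ne (v 1) 0 with h1 | h1
    · have h0 : v 0 ≠ 0 := fun h0 => hv (funext (Fin.forall_fin_two.2 ⟨h0, h1⟩))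
      rw [h1, mul_zero, add_zero, zero_pow two_ne_zero, mul_zero, add_zero]
      positivity
    · positivity

theorem exists_eq_of_posDef_fin_two {A : Matrix (Fin 2) (Fin 2) ℝ} (hA : A.PosDef) :
    ∃ x y z, A = !![x, z; z, y] := by
  refine ⟨A 0 0, A 1 1, A 0 1, ?_⟩
  conv_lhs => rw [A.eta_fin_two, ← hA.isHermitian.apply 1 0, star_trivial]

theorem add_add_two_mul_pos {x y z : ℝ} (hx : 0 < x) (hy : 0 < y) (hD : 0 < x * y - z ^ 2) :
    0 < x + y + 2 * z := by
  by_contra! h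
  nlinarith [sq_nonneg (x - y)]

theorem inv_fin_one (s : ℝ) : (!![s] : Matrix (Fin 1) (Fin 1) ℝ)⁻¹ = !![s⁻¹] := by
  rw [Matrix.inv_subsingleton, Ring.inverse_eq_inv']
  ext i j
  fin_cases i
  fin_cases j
  rfl

theorem inv_fin_two_symm (x y z : ℝ) :
    (!![x, z; z, y] : Matrix (Fin 2) (Fin 2) ℝ)⁻¹ =
      !![y / (x * y - z ^ 2), -z / (x * y - z ^ 2);
        -z / (x * y - z ^ 2), x / (x * y - z ^ 2)] := by
  rw [Matrix.inv_def, Matrix.det_fin_two_of, Matrix.adjugate_fin_two_of, Ring.inverse_eq_inv', ← sq]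
  ext i j
  fin_cases i <;> fin_cases j <;> simp [div_eq_inv_mul]

theorem youngMap_mul_mul_transpose (x y z : ℝ) (i : Fin 3) :
    youngMap i * !![x, z; z, y] * (youngMap i)ᵀ = !![![x + y + 2 * z, y, x] i] := by
  ext a b
  fin_cases a
  fin_cases b
  fin_cases i <;> simp [youngMap, Matrix.mul_apply, Fin.sum_univ_two]
  ring

theorem sum_smul_transpose_youngMap_mul (c : Fin 3 → ℝ) (x y z : ℝ) :
    ∑ i, c i • ((youngMap i)ᵀ * (youngMap i * !![x, z; z, y] * (youngMap i)ᵀ)⁻¹ * youngMap i) =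
      !![c 0 / (x + y + 2 * z) + c 2 / x, c 0 / (x + y + 2 * z);
        c 0 / (x + y + 2 * z), c 0 / (x + y + 2 * z) + c 1 / y] := by
  simp_rw [youngMap_mul_mul_transpose, inv_fin_one, Fin.sum_univ_three]
  ext i j
  fin_cases i <;> fin_cases j <;> simp [youngMap, Matrix.mul_apply, div_eq_mul_inv]

theorem inverse_entries_eq_iff {c₁ c₂ c₃ x y z : ℝ} (hx : x ≠ 0) (hy : y ≠ 0)
    (hs : x + y + 2 * z ≠ 0) (hD : x * y - z ^ 2 ≠ 0) :
    (y / (x * y - z ^ 2) = c₁ / (x + y + 2 * z) + c₃ / x ∧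
      -z / (x * y - z ^ 2) = c₁ / (x + y + 2 * z) ∧
      x / (x * y - z ^ 2) = c₁ / (x + y + 2 * z) + c₂ / y) ↔
      (1 - c₂) * (x * y) + y * z + c₂ * z ^ 2 = 0 ∧
      (1 - c₃) * (x * y) + x * z + c₃ * z ^ 2 = 0 ∧
      c₁ + c₂ + c₃ = 2 := by
  have entry₁₂ : -z / (x * y - z ^ 2) = c₁ / (x + y + 2 * z) ↔
      -z * (x + y + 2 * z) = c₁ * (x * y - z ^ 2) := div_eq_div_iff hD hs
  have entry₁₁ : y / (x * y - z ^ 2) = -z / (x * y - z ^ 2) + c₃ / x ↔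
      (y + z) * x = c₃ * (x * y - z ^ 2) := by
    rw [← sub_eq_iff_eq_add', ← sub_div, sub_neg_eq_add, div_eq_div_iff hD hx]
  have entry₂₂ : x / (x * y - z ^ 2) = -z / (x * y - z ^ 2) + c₂ / y ↔
      (x + z) * y = c₂ * (x * y - z ^ 2) := by
    rw [← sub_eq_iff_eq_add', ← sub_div, sub_neg_eq_add, div_eq_div_iff hD hy]
  constructor
  · rintro ⟨h₁₁, h₁₂, h₂₂⟩
    rw [← h₁₂, entry₁₁] at h₁₁
    rw [← h₁₂, entry₂₂] at h₂₂
    rw [entry₁₂] at h₁₂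
    refine ⟨by linear_combination h₂₂, by linear_combination h₁₁, mul_right_cancel₀ hD ?_⟩
    linear_combination -h₁₁ - h₁₂ - h₂₂
  · rintro ⟨h₂₂, h₁₁, hsum⟩
    have h₁₂ := entry₁₂.2 (by linear_combination -(x * y - z ^ 2) * hsum - h₂₂ - h₁₁)
    rw [← h₁₂, entry₁₁, entry₂₂]
    exact ⟨by linear_combination h₁₁, rfl, by linear_combination h₂₂⟩

theorem youngDatum_matrixCondition_iff (c : Fin 3 → ℝ) (hc : ∀ i, 0 < c i) (x y z : ℝ)
    (hA : !![x, z; z, y].PosDef) :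
    (youngDatum c hc).MatrixCondition !![x, z; z, y] ↔
      (1 - c 1) * (x * y) + y * z + c 1 * z ^ 2 = 0 ∧
      (1 - c 2) * (x * y) + x * z + c 2 * z ^ 2 = 0 ∧
      c 0 + c 1 + c 2 = 2 := by
  obtain ⟨hx, hD⟩ := posDef_fin_two_iff.1 hA
  have hy : 0 < y := hA.diag_pos (i := 1)
  rw [← inverse_entries_eq_iff hx.ne' hy.ne' (add_add_two_mul_pos hx hy hD).ne' hD.ne']
  change !![x, z; z, y]⁻¹ = ∑ i, c i • ((youngMap i)ᵀ *
    (youngMap i * !![x, z; z, y] * (youngMap i)ᵀ)⁻¹ * youngMap i) ↔ _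
  rw [inv_fin_two_symm, sum_smul_transpose_youngMap_mul, ← Matrix.ext_iff]
  simp only [Fin.forall_fin_two, Matrix.of_apply, Matrix.cons_val_zero, Matrix.cons_val_one,
    and_assoc, and_self_left]

theorem quadratic_system_iff {c₂ c₃ : ℝ} (h₂ : c₂ ≠ 1) (h₃ : c₃ ≠ 1) {x y z : ℝ} (hz : z ≠ 0) :
    ((1 - c₂) * (x * y) + y * z + c₂ * z ^ 2 = 0 ∧
      (1 - c₃) * (x * y) + x * z + c₃ * z ^ 2 = 0 ↔
      (∃ t : ℝ, x = t ∧ y = t ∧ z = -t) ∨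
      (∃ t : ℝ, x = t * (c₃ * (1 - c₃)) ∧ y = t * (c₂ * (1 - c₂)) ∧
        z = -(t * ((1 - c₂) * (1 - c₃))))) := by
  constructor
  · rintro ⟨e₁, e₂⟩
    have n₂ : 1 - c₂ ≠ 0 := sub_ne_zero.2 h₂.symm
    have n₃ : 1 - c₃ ≠ 0 := sub_ne_zero.2 h₃.symm
    have linear_relation : (1 - c₃) * y = (1 - c₂) * x - (c₂ - c₃) * z :=
      mul_right_cancel₀ hz (by linear_combination (1 - c₃) * e₁ - (1 - c₂) * e₂)
    have factored : (x + z) * ((1 - c₂) * x + c₃ * z) = 0 := by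
      linear_combination e₂ - x * linear_relation
    rcases mul_eq_zero.1 factored with h | h
    · refine Or.inl ⟨x, rfl, mul_left_cancel₀ n₃ ?_, (neg_eq_of_add_eq_zero_right h).symm⟩
      linear_combination linear_relation - (c₂ - c₃) * h
    · refine Or.inr ⟨-z / ((1 - c₂) * (1 - c₃)), ?_, ?_, ?_⟩ <;> field_simp
      · linear_combination h
      · linear_combination linear_relation + h
  · rintro (⟨t, rfl, rfl, rfl⟩ | ⟨t, rfl, rfl, rfl⟩) <;> constructor <;> ring

/-! ### The value of the constant -/

/-- The covariance matrix, up to scaling, of the maximizing Gaussians: the positive definite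
solution of the matrix condition for the datum of Young's inequality. The remaining weight `c₁`
is `2 - c₂ - c₃`. -/
def extremalMatrix (c₂ c₃ : ℝ) : Matrix (Fin 2) (Fin 2) ℝ :=
  !![c₃ * (1 - c₃), -((1 - c₂) * (1 - c₃)); -((1 - c₂) * (1 - c₃)), c₂ * (1 - c₂)]

theorem smul_extremalMatrix (t c₂ c₃ : ℝ) :
    t • extremalMatrix c₂ c₃ =
      !![t * (c₃ * (1 - c₃)), -(t * ((1 - c₂) * (1 - c₃)));
        -(t * ((1 - c₂) * (1 - c₃))), t * (c₂ * (1 - c₂))] := by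
  simp only [extremalMatrix, Matrix.smul_of, Matrix.smul_cons, Matrix.smul_empty, smul_eq_mul,
    mul_neg]

theorem gaussianValue_youngDatum (c : Fin 3 → ℝ) (hc : ∀ i, 0 < c i) (x y z : ℝ) :
    (youngDatum c hc).gaussianValue !![x, z; z, y] =
      √((x * y - z ^ 2) / ((x + y + 2 * z) ^ c 0 * y ^ c 1 * x ^ c 2)) := by
  change √(Matrix.det !![x, z; z, y] /
    ∏ i, (youngMap i * !![x, z; z, y] * (youngMap i)ᵀ).det ^ c i) = _
  simp only [youngMap_mul_mul_transpose, Matrix.det_fin_two_of, Matrix.det_fin_one_of,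
    Fin.prod_univ_three, Matrix.cons_val, ← sq]

namespace IsYoungTriple

variable {c₁ c₂ c₃ : ℝ} (h : IsYoungTriple c₁ c₂ c₃)

include h

theorem det_smul_extremalMatrix (t : ℝ) :
    t * (c₃ * (1 - c₃)) * (t * (c₂ * (1 - c₂))) - (-(t * ((1 - c₂) * (1 - c₃)))) ^ 2 =
      t ^ 2 * ((1 - c₁) * (1 - c₂) * (1 - c₃)) := by
  obtain rfl : c₁ = 2 - c₂ - c₃ := by linarith [h.sum_eq_two]
  ring

theorem sum_smul_extremalMatrix (t : ℝ) :
    t * (c₃ * (1 - c₃)) + t * (c₂ * (1 - c₂)) + 2 * -(t * ((1 - c₂) * (1 - c₃))) =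
      t * (c₁ * (1 - c₁)) := by
  obtain rfl : c₁ = 2 - c₂ - c₃ := by linarith [h.sum_eq_two]
  ring

theorem posDef_smul_extremalMatrix {t : ℝ} (ht : 0 < t) : (t • extremalMatrix c₂ c₃).PosDef := by
  have := h.one_sub_pos₁
  have := h.one_sub_pos₂
  have := h.one_sub_pos₃
  have := h.pos₃
  rw [smul_extremalMatrix, posDef_fin_two_iff, h.det_smul_extremalMatrix]
  constructor <;> positivity

theorem sq_mul_div_prod_mul_rpow {t v₁ v₂ v₃ : ℝ} (ht : 0 < t) (hv₁ : 0 ≤ v₁) (hv₂ : 0 ≤ v₂)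
    (hv₃ : 0 ≤ v₃) (d : ℝ) :
    t ^ 2 * d / ((t * v₁) ^ c₁ * (t * v₂) ^ c₂ * (t * v₃) ^ c₃) =
      d / (v₁ ^ c₁ * v₂ ^ c₂ * v₃ ^ c₃) := by
  have scaling : t ^ c₁ * t ^ c₂ * t ^ c₃ = t ^ 2 := by
    rw [← Real.rpow_add ht, ← Real.rpow_add ht, h.sum_eq_two, Real.rpow_two]
  rw [Real.mul_rpow ht.le hv₁, Real.mul_rpow ht.le hv₂, Real.mul_rpow ht.le hv₃,
    ← mul_div_mul_left d _ (pow_pos ht 2).ne', ← scaling]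
  congr 1
  ring

end IsYoungTriple

section YoungDatum

variable {c : Fin 3 → ℝ} (hc : ∀ i, 0 < c i) (h : IsYoungTriple (c 0) (c 1) (c 2))

include h

theorem posDef_and_matrixCondition_iff {A : Matrix (Fin 2) (Fin 2) ℝ} :
    A.PosDef ∧ (youngDatum c hc).MatrixCondition A ↔
      ∃ t : ℝ, 0 < t ∧ A = t • extremalMatrix (c 1) (c 2) := by
  constructor
  · rintro ⟨hA, hcond⟩
    obtain ⟨x, y, z, rfl⟩ := exists_eq_of_posDef_fin_two hA
    obtain ⟨hx, hD⟩ := posDef_fin_two_iff.1 hA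
    obtain ⟨e₂, e₃, -⟩ := (youngDatum_matrixCondition_iff c hc x y z hA).1 hcond
    have hz : z ≠ 0 := by
      rintro rfl
      rw [zero_pow two_ne_zero, sub_zero] at hD
      exact (mul_pos h.one_sub_pos₂ hD).ne' (by linear_combination e₂)
    rcases (quadratic_system_iff h.lt_one₂.ne h.lt_one₃.ne hz).1 ⟨e₂, e₃⟩ with
      ⟨t, rfl, rfl, rfl⟩ | ⟨t, rfl, rfl, rfl⟩
    · exact absurd hD (by rw [neg_sq, ← sq, sub_self]; exact lt_irrefl 0)
    · exact ⟨t, pos_of_mul_pos_left hx (mul_pos h.pos₃ h.one_sub_pos₃).le,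
        (smul_extremalMatrix t (c 1) (c 2)).symm⟩
  · rintro ⟨t, ht, rfl⟩
    have hA := h.posDef_smul_extremalMatrix ht
    refine ⟨hA, ?_⟩
    rw [smul_extremalMatrix] at hA ⊢
    exact (youngDatum_matrixCondition_iff c hc _ _ _ hA).2 ⟨by ring, by ring, h.sum_eq_two⟩

theorem gaussianValue_eq_gaussianConstant {A : Matrix (Fin 2) (Fin 2) ℝ} (hA : A.PosDef)
    (hcond : (youngDatum c hc).MatrixCondition A) :
    (youngDatum c hc).gaussianValue A = gaussianConstant (c 0) (c 1) (c 2) := by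
  obtain ⟨t, ht, rfl⟩ := (posDef_and_matrixCondition_iff hc h).1 ⟨hA, hcond⟩
  rw [smul_extremalMatrix, gaussianValue_youngDatum, h.det_smul_extremalMatrix,
    h.sum_smul_extremalMatrix, h.gaussianConstant_eq, h.sq_mul_div_prod_mul_rpow ht
      (mul_pos h.pos₁ h.one_sub_pos₁).le (mul_pos h.pos₂ h.one_sub_pos₂).le
      (mul_pos h.pos₃ h.one_sub_pos₃).le]

theorem isConstant_youngDatum :
    (youngDatum c hc).IsConstant (gaussianConstant (c 0) (c 1) (c 2)) := by
  simpa only [BrascampLiebDatum.IsConstant, youngDatum_inequality_iff] using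
    h.isLeast_trilinearInequality

end YoungDatum

theorem rpow_one_div_self {s : ℝ} (hs : 0 ≤ s) : s ^ (1 / s) = ((1 / s) ^ (1 / s))⁻¹ := by
  rw [one_div, Real.inv_rpow hs, inv_inv]

theorem conjExponent_rpow_one_div_self {s : ℝ} (hs : 1 < s) :
    s.conjExponent ^ (1 / s.conjExponent) = ((1 - 1 / s) ^ (1 - 1 / s))⁻¹ := by
  have hconj := Real.HolderConjugate.conjExponent hs
  rw [rpow_one_div_self hconj.symm.pos.le, one_div, one_div, hconj.one_sub_inv]

theorem becknerConstant_eq_gaussianConstant {p q r : ℝ} (hp : 1 < p) (hq : 1 < q) (hr : 1 < r) :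
    becknerConstant p q r = gaussianConstant (1 / p) (1 / q) (1 - 1 / r) := by
  rw [becknerConstant, gaussianConstant, conjExponent_rpow_one_div_self hp,
    conjExponent_rpow_one_div_self hq, conjExponent_rpow_one_div_self hr,
    rpow_one_div_self (zero_le_one.trans hp.le), rpow_one_div_self (zero_le_one.trans hq.le),
    rpow_one_div_self (zero_le_one.trans hr.le), sub_sub_cancel]
  congr 1
  simp only [div_eq_mul_inv, mul_inv, inv_inv]
  ring

theorem mainTheorem5 {𝕜 : Type*} [RCLike 𝕜] (p q r : ℝ) (hp : 1 < p) (hq : 1 < q) (hr : 1 < r)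
    (hpqr : 1 / p + 1 / q = 1 + 1 / r)
    (c₁ c₂ c₃ : ℝ) (h₁ : c₁ = 1 / p) (h₂ : c₂ = 1 / q) (h₃ : c₃ = 1 - 1 / r) :
    -- the convolution of `F ∈ L_p` and `G ∈ L_q` is well defined and belongs to `L_r`
    (∀ F G : ℝ → 𝕜, MemLp F (ENNReal.ofReal p) volume → MemLp G (ENNReal.ofReal q) volume →
      (∀ᵐ x : ℝ, ConvolutionExistsAt F G x (ContinuousLinearMap.mul 𝕜 𝕜) volume) ∧
      MemLp (lineConvolution F G) (ENNReal.ofReal r) volume) ∧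
    -- the best constant in Young's inequality, which is smaller than `1`
    IsLeast {C : ℝ | YoungInequality 𝕜 p q r C} (becknerConstant p q r) ∧
    becknerConstant p q r < 1 ∧
    -- it is the best constant in the dual trilinear inequality
    IsLeast {C : ℝ | TrilinearInequality c₁ c₂ c₃ C} (becknerConstant p q r) ∧
    -- that is, the Brascamp-Lieb constant of the associated datum
    (youngDatum (youngWeight p q r) (youngWeight_pos hp hq hr)).IsConstant
      (becknerConstant p q r) ∧
    -- the condition on a positive definite `A`, in coordinates
    (∀ (c : Fin 3 → ℝ) (hc : ∀ i, 0 < c i) (x y z : ℝ), !![x, z; z, y].PosDef →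
      ((youngDatum c hc).MatrixCondition !![x, z; z, y] ↔
        (1 - c 1) * (x * y) + y * z + c 1 * z ^ 2 = 0 ∧
        (1 - c 2) * (x * y) + x * z + c 2 * z ^ 2 = 0 ∧
        c 0 + c 1 + c 2 = 2)) ∧
    -- the two families of solutions of the first two equations
    (∀ x y z : ℝ, z ≠ 0 →
      ((1 - c₂) * (x * y) + y * z + c₂ * z ^ 2 = 0 ∧
        (1 - c₃) * (x * y) + x * z + c₃ * z ^ 2 = 0 ↔
        (∃ t : ℝ, x = t ∧ y = t ∧ z = -t) ∨
        (∃ t : ℝ, x = t * (c₃ * (1 - c₃)) ∧ y = t * (c₂ * (1 - c₂)) ∧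
          z = -(t * ((1 - c₂) * (1 - c₃)))))) ∧
    -- the positive definite solutions
    (∀ A : Matrix (Fin 2) (Fin 2) ℝ,
      A.PosDef ∧
        (youngDatum (youngWeight p q r) (youngWeight_pos hp hq hr)).MatrixCondition A ↔
      ∃ t : ℝ, 0 < t ∧
        A = t • !![c₃ * (1 - c₃), -((1 - c₂) * (1 - c₃));
          -((1 - c₂) * (1 - c₃)), c₂ * (1 - c₂)]) ∧
    -- the value of the constant in terms of `A`, and in terms of the weights
    (∀ A : Matrix (Fin 2) (Fin 2) ℝ, A.PosDef →
      (youngDatum (youngWeight p q r) (youngWeight_pos hp hq hr)).MatrixCondition A →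
      becknerConstant p q r =
        (youngDatum (youngWeight p q r) (youngWeight_pos hp hq hr)).gaussianValue A) ∧
    becknerConstant p q r =
      √(((1 - c₁) ^ (1 - c₁) * (1 - c₂) ^ (1 - c₂) * (1 - c₃) ^ (1 - c₃)) /
        (c₁ ^ c₁ * c₂ ^ c₂ * c₃ ^ c₃)) := by
  subst h₁ h₂ h₃
  have hp₀ : 0 < p := zero_lt_one.trans hp
  have hq₀ : 0 < q := zero_lt_one.trans hq
  have hY := isYoungTriple_of_exponents hp hq hr hpqr
  have hw := youngWeight_pos hp hq hr
  have hK := becknerConstant_eq_gaussianConstant hp hq hr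
  have hleast : IsLeast {C | TrilinearInequality (1 / p) (1 / q) (1 - 1 / r) C}
      (becknerConstant p q r) := hK ▸ hY.isLeast_trilinearInequality
  have young := youngInequality_of_trilinearInequality (𝕜 := 𝕜) hp₀ hq₀ hr hleast.1
  exact ⟨fun F G hF hG => ⟨ae_convolutionExistsAt hp₀ hq₀ hr hleast.1 hF hG,
      young.memLp_lineConvolution hF hG⟩,
    ⟨young, fun C hC => hleast.2 (hC.trilinearInequality hp₀ hq₀ hr hleast.1)⟩,
    hK ▸ hY.gaussianConstant_lt_one, hleast, hK ▸ isConstant_youngDatum hw hY,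
    youngDatum_matrixCondition_iff, fun x y z => quadratic_system_iff hY.lt_one₂.ne hY.lt_one₃.ne,
    fun A => posDef_and_matrixCondition_iff hw hY,
    fun A hA hcond => hK.trans (gaussianValue_eq_gaussianConstant hw hY hA hcond).symm, hK⟩
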